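/- Let $d\ge 1$, let $G=(V,E)$ be a graph on $n$ vertices that is minimally rigid in $\mathbb{R}^d$, and let $K\subseteq V$ span a complete subgraph $K_d$ of $G$. Put $V'=V\setminus K$ and $E'=E\setminus \mathrm{edges}(K_d)$. For fixed points $p_v\in\mathbb{C}^d$ ($v\in K$) and edge lengths $\lambda_{e}\in\mathbb{C}$ ($e\in E'$), let $F$ be the system of sphere equations $$\textstyle\sum_{k=1}^d x_{u,k}^2-s_u=0\ (u\in V'),\qquad s_u+s_v-2\sum_{k=1}^d x_{u,k}x_{v,k}-\lambda_{uv}^2=0\ (uv\in E')$$ in the $m=(d+1)(n-d)$ variables $X_u=\{x_{u,1},\dots,x_{u,d},s_u\}$, $u\in V'$, where $x_{v,k}=p_{v,k}$ and $s_v=\sum_k p_{v,k}^2$ for $v\in K$. Let $T^u$ be the convex hull of the origin and the unit vectors of the variables in $X_u$. The m-Bézout polytope of an equation $f$ is $\sum_{u\in V'}\deg_{X_u}(f)\,T^u$, and $B_G$ is the Minkowski sum of the m-Bézout polytopes of the equations of $F$. For $w\in\mathbb{Z}^m$ the face system $F^w$ consists of the initial forms $f^w$, i.e. the sums of those terms of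 $f$ whose exponent vectors minimize the inner product with $w$ among the exponent vectors of $f$. With the m-Bézout polytopes in place of the Newton polytopes, *Bernstein's condition* says: for every $w\neq 0$ that is a sum of distinct primitive inner facet normals of $B_G$ (each proper nonempty face of $B_G$ has such a normal), $F^w$ has no solution in $(\mathbb{C}^*)^m$. For $L:V'\to\{1,\dots,d\}$ let $\widetilde F_L(\mathbf t)$ be the polynomial system obtained from $F$ by substituting $$x_{u,L(u)}=\frac1{t_{u,L(u)}},\qquad x_{u,i}=\frac{t_{u,i}}{t_{u,L(u)}}\ (i\ne L(u),\ \text{with } x_{u,d+1}=s_u)$$ and multiplying each resulting Laurent polynomial, which comes from an equation $f$, by $\prod_{u\in V'}t_{u,L(u)}^{\deg_{X_u}(f)}$. Then, for generic $(p,\lambda)$, that is, for all $(p,\lambda)$ at which a certain nonzero polynomial depending only on $G$, $d$ and $K$ does not vanish, and for every $u_0\in V'$ and $k_0\in\{1,\dots,d\}$: there are exactly $2^{(d+2)(n-d)}$ sets of primitive inner facet normals of $B_G$ (the naive count), whereas Bernstein's condition for $F$ can be verified by checking $(n-d)\cdot d^{\,n-d-1}$ systems. Namely, there are $(n-d)\cdot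 d^{\,n-d-1}$ pairs $(L,u)$ with $L:V'\to\{1,\dots,d\}$, $L(u_0)=k_0$, $u\in V'$, and Bernstein's condition holds if and only if for none of these pairs the system $\widetilde F_L(\mathbf t)$ with $t_{u,L(u)}=0$ has a solution in $\mathbb{C}^m$. -/

import Mathlib

open scoped Pointwise

noncomputable section

namespace SphereEquations

/-! ### Rigidity of graphs -/

section Rigidity

variable {V : Type*} (G : SimpleGraph V) {d : ℕ}

/-- `q` induces the same edge lengths on `G` as `p`. -/
def SameEdgeLengths (p q : V → EuclideanSpace ℝ (Fin d)) : Prop :=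
  ∀ u v, G.Adj u v → dist (q u) (q v) = dist (p u) (p v)

/-- `p` and `q` agree up to a rigid motion (an isometry of `ℝ^d`). -/
def Congruent (p q : V → EuclideanSpace ℝ (Fin d)) : Prop :=
  ∃ g : EuclideanSpace ℝ (Fin d) ≃ᵢ EuclideanSpace ℝ (Fin d), ∀ v, q v = g (p v)

/-- The embedding `p` of `G` is rigid: up to rigid motions, only finitely many embeddings
have the edge lengths induced by `p`. -/
def IsRigidEmbedding (p : V → EuclideanSpace ℝ (Fin d)) : Prop :=
  ∃ T : Set (V → EuclideanSpace ℝ (Fin d)), T.Finite ∧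
    ∀ q, SameEdgeLengths G p q → ∃ r ∈ T, Congruent r q

/-- The embedding `p` of `G` is generic: a small perturbation of the embedded vertices does
not alter whether the embedding is rigid or flexible. -/
def IsGenericEmbedding (p : V → EuclideanSpace ℝ (Fin d)) : Prop :=
  ∀ᶠ q in nhds p, (IsRigidEmbedding G q ↔ IsRigidEmbedding G p)

/-- `G` is generically rigid in `ℝ^d`. -/
def GenericallyRigid (d : ℕ) : Prop :=
  ∀ p : V → EuclideanSpace ℝ (Fin d), IsGenericEmbedding G p → IsRigidEmbedding G p

/-- `G` is minimally rigid in `ℝ^d`: it is generically rigid, and the removal of any edge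
breaks the rigidity. -/
def MinimallyRigid (d : ℕ) : Prop :=
  GenericallyRigid G d ∧ ∀ e ∈ G.edgeSet, ¬ GenericallyRigid (G.deleteEdges {e}) d

end Rigidity

/-! ### Initial forms and m-Bézout polytopes -/

section Polytopes

/-- The initial form `f^w`: the part of `f` carried by the exponent vectors that minimize the
inner product with `w`. -/
def initialForm {σ : Type*} [Fintype σ] (w : σ → ℤ) (f : MvPolynomial σ ℂ) :
    MvPolynomial σ ℂ :=
  open Classical in
  ∑ α ∈ f.support.filter
      (fun α => ∀ β ∈ f.support, ∑ a, (α a : ℤ) * w a ≤ ∑ a, (β a : ℤ) * w a),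
    MvPolynomial.monomial α (f.coeff α)

/-- The subset `P^w` of `P` on which the inner product with `w` is minimal. -/
def minFace {σ : Type*} [Fintype σ] (P : Set (σ → ℝ)) (w : σ → ℝ) : Set (σ → ℝ) :=
  {x ∈ P | ∀ y ∈ P, x ⬝ᵥ w ≤ y ⬝ᵥ w}

/-- The primitive integer inner normals of the facets of a full-dimensional polytope `P`. -/
def facetNormals {σ : Type*} [Fintype σ] (P : Set (σ → ℝ)) : Set (σ → ℤ) :=
  {w | Finset.univ.gcd w = 1 ∧ (minFace P (fun a => (w a : ℝ))).Nonempty ∧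
    Module.finrank ℝ (vectorSpan ℝ (minFace P (fun a => (w a : ℝ)))) + 1 = Fintype.card σ}

/-- The vector sums of facet normals, zero excluded.  Every proper nonempty face of `P` has
such a normal, namely the sum of the normals of the facets that contain it. -/
def faceNormals {σ : Type*} [Fintype σ] (P : Set (σ → ℝ)) : Set (σ → ℤ) :=
  {w | w ≠ 0 ∧ ∃ S : Finset (σ → ℤ), (S : Set (σ → ℤ)) ⊆ facetNormals P ∧ w = ∑ v ∈ S, v}

variable {U I : Type*} [Fintype U] [DecidableEq U] [Fintype I] [DecidableEq I]

/-- The degree of a polynomial in the block `X_u = {x_{u,i} : i ∈ I}` of variables. -/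
def blockDegree (u : U) (f : MvPolynomial (U × I) ℂ) : ℕ :=
  f.support.sup (fun α => ∑ i, α (u, i))

/-- The simplex `T^u` of the block `X_u`: the hull of the origin and the `e_{u,i}`. -/
def blockSimplex (u : U) : Set (U × I → ℝ) :=
  convexHull ℝ (insert 0 (Set.range fun i : I => Pi.single (u, i) (1 : ℝ)))

/-- The m-Bézout polytope of `f` with respect to the partition of the variables in blocks. -/
def mBezoutPolytope (f : MvPolynomial (U × I) ℂ) : Set (U × I → ℝ) :=
  ∑ u : U, (blockDegree u f : ℝ) • blockSimplex u

/-- The Minkowski sum of the m-Bézout polytopes of a system. -/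
def mBezoutSum {J : Type*} [Fintype J] (F : J → MvPolynomial (U × I) ℂ) : Set (U × I → ℝ) :=
  ∑ j : J, mBezoutPolytope (F j)

/-- Bernstein's condition for the system `F`, with the m-Bézout polytopes in place of the
Newton polytopes: no face system `F^w` has a solution with all coordinates nonzero. -/
def BernsteinCondition {J : Type*} [Fintype J] (F : J → MvPolynomial (U × I) ℂ) : Prop :=
  ∀ w ∈ faceNormals (mBezoutSum F),
    ¬ ∃ x : U × I → ℂ, (∀ a, x a ≠ 0) ∧ ∀ j, MvPolynomial.eval x (initialForm w (F j)) = 0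

/-- The transformed polynomial `f̃(t)` for the choice `x_{u,L(u)}` of `δ`-variables.
The substitution `x_{u,L(u)} ↦ 1/t_{u,L(u)}`, `x_{u,i} ↦ t_{u,i}/t_{u,L(u)}` (`i ≠ L(u)`) turns
the monomial `x^α` into a Laurent monomial in which `t_{u,L(u)}` has the exponent
`-∑ i, α_{u,i}` and `t_{u,i}` the exponent `α_{u,i}`; its result is then multiplied by the least
powers of the `t_{u,L(u)}` that clear the denominators, namely the `blockDegree u f`-th ones. -/
def deltaTransform (L : U → I) (f : MvPolynomial (U × I) ℂ) : MvPolynomial (U × I) ℂ :=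
  ∑ α ∈ f.support,
    MvPolynomial.monomial
      (Finsupp.equivFunOnFinite.symm fun a : U × I =>
        if a.2 = L a.1 then blockDegree a.1 f - ∑ i, α (a.1, i) else α a)
      (f.coeff α)

end Polytopes

/-! ### The sphere equations -/

section System

variable {V : Type*} [Fintype V] [DecidableEq V] (G : SimpleGraph V) (K : Finset V) {d : ℕ}

/-- The vertices that are not fixed. -/
abbrev FreeVertex : Type _ := {v : V // v ∉ K}

/-- The edges of `G` with an endpoint that is not fixed; when `K` spans a complete subgraph
these are the edges of `G` that are not edges of this subgraph. -/
abbrev FreeEdge : Type _ := {e : Sym2 V // e ∈ G.edgeSet ∧ ∃ v ∈ e, v ∉ K}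

instance : Fintype (FreeEdge G K) := Fintype.ofFinite _

/-- The variables: `(u, some k)` is the coordinate `x_{u,k}`, and `(u, none)` is `s_u`. -/
abbrev Var (d : ℕ) : Type _ := FreeVertex K × Option (Fin d)

/-- The `k`-th coordinate of `v`: a variable, or a constant if `v` is fixed. -/
def coord (p : {v : V // v ∈ K} → Fin d → ℂ) (v : V) (k : Fin d) : MvPolynomial (Var K d) ℂ :=
  if h : v ∈ K then MvPolynomial.C (p ⟨v, h⟩ k) else MvPolynomial.X (⟨v, h⟩, some k)

/-- The magnitude of `v`: the variable `s_v`, or a constant if `v` is fixed. -/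
def magnitude (p : {v : V // v ∈ K} → Fin d → ℂ) (v : V) : MvPolynomial (Var K d) ℂ :=
  if h : v ∈ K then MvPolynomial.C (∑ k, p ⟨v, h⟩ k ^ 2) else MvPolynomial.X (⟨v, h⟩, none)

/-- The polynomial `s_u + s_v - 2⟨X_u, X_v⟩ - l²` of the pair `{u, v}`. -/
def edgePolynomial (p : {v : V // v ∈ K} → Fin d → ℂ) (l : ℂ) :
    Sym2 V → MvPolynomial (Var K d) ℂ :=
  Sym2.lift ⟨fun u v => magnitude K p u + magnitude K p v
      - 2 * ∑ k, coord K p u k * coord K p v k - MvPolynomial.C (l ^ 2), by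
    intro u v
    simp only [mul_comm (coord K p u _), add_comm (magnitude K p u)]⟩

/-- The sphere equations of `G` with fixed points `p` on `K` and edge lengths `lam`: a
magnitude equation for each free vertex and an edge equation for each free edge. -/
def sphereEquations (p : {v : V // v ∈ K} → Fin d → ℂ) (lam : FreeEdge G K → ℂ) :
    FreeVertex K ⊕ FreeEdge G K → MvPolynomial (Var K d) ℂ :=
  Sum.elim
    (fun u => ∑ k : Fin d, MvPolynomial.X (u, some k) ^ 2 - MvPolynomial.X (u, none))
    (fun e => edgePolynomial K p (lam e) e.1)

/-- The list of checks: a choice of one coordinate variable for every free vertex as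
`δ`-variable, where the choice for `u₀` is prescribed to be `k₀`, together with the free vertex
whose `δ`-variable is evaluated to zero. -/
def checks (u₀ : FreeVertex K) (k₀ : Fin d) :
    Set ((FreeVertex K → Fin d) × FreeVertex K) :=
  {c | c.1 u₀ = k₀}

/-- The system `F̃(t, t_{u,L(u)} = 0)` has a solution with complex coordinates. -/
def ZeroEvaluationSolvable (p : {v : V // v ∈ K} → Fin d → ℂ) (lam : FreeEdge G K → ℂ)
    (L : FreeVertex K → Fin d) (u : FreeVertex K) : Prop :=
  ∃ t : Var K d → ℂ, t (u, some (L u)) = 0 ∧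
    ∀ j, MvPolynomial.eval t
      (deltaTransform (fun v => some (L v)) (sphereEquations G K p lam j)) = 0

end System

end SphereEquations

end

/-! The bridge between the two conditions is the system obtained by homogenizing every equation
separately in each block, with one new coordinate `h u` per free vertex; `h u = 0` puts `u` at
infinity.

The polytope is a product of scaled simplices. Its facet normals are the unit vectors and, for each
block `u`, the vector equal to -1 on that block and 0 elsewhere. A sum of distinct ones is therefore
-1 on the blocks of some set `B` plus 1 on some set `Z` of variables. A torus solution of the face
system becomes, after setting the variables in `Z` to zero, a solution of the homogenized system
(`IsHomSolution`) with exactly the vertices of `B` at infinity. Conversely, a torus solution of the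
homogenized system with a nonempty `B` at infinity refutes Bernstein's condition, through the sum of
the block normals of `B`. The transform for `L` is the same homogenized system in the chart where
the coordinate chosen by `L` is 1 and the δ-variable plays the role of `h u` (`eval_deltaTransform`,
`zeroEvaluationSolvable_iff`).

Two generic facts close the gap. For `B` empty, the failing direction would produce a finite
solution with a vanishing coordinate. Pairs of fixed and free points with such a coordinate form a
hypersurface, and since rigidity gives at least `d (n - d)` free edges, its image among the
parameters lies in a hypersurface (`GenericallyRigid.card_le`, `exists_vanishing_on_image`). For `B`
nonempty, translations and rotations of complex space act on solutions, altering `p` but not the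
lengths, and small ones remove zero coordinates. By Chevalley's theorem, torus solvability is
constant for generic parameters, so it passes from the moved parameters back to the original ones
(`exists_generic_torus`). A torus solution at infinity serves every `L`, so the choice at `u₀` may
be prescribed. -/

namespace SphereEquations

/-! ### Generic behaviour of polynomial systems with parameters -/

section Generic

open MvPolynomial

variable {P Z J : Type*}

/-- Chevalley's theorem for a system of polynomial equations with parameters: it is solvable
for generic parameters, or unsolvable for generic parameters. -/
theorem exists_generic_dichotomy [Finite P] [Finite Z]
    (f : J → MvPolynomial (P ⊕ Z) ℂ) :
    ∃ Q : MvPolynomial P ℂ, Q ≠ 0 ∧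
      ((∀ a, eval a Q ≠ 0 → ∃ z, ∀ j, eval (Sum.elim a z) (f j) = 0) ∨
        ∀ a, eval a Q ≠ 0 → ¬ ∃ z, ∀ j, eval (Sum.elim a z) (f j) = 0) := by
  set I : Ideal (MvPolynomial (P ⊕ Z) ℂ) := Ideal.span (Set.range f) with hI
  let φ : MvPolynomial P ℂ →ₐ[ℂ] MvPolynomial (P ⊕ Z) ℂ ⧸ I :=
    (Ideal.Quotient.mkₐ ℂ I).comp (rename Sum.inl)
  by_cases hφ : Function.Injective φ
  · have hfp : φ.toRingHom.FinitePresentation := by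
      have : φ.FiniteType := by
        have h : (φ.comp (Algebra.ofId ℂ _)).FiniteType := by
          have : φ.comp (Algebra.ofId ℂ _) = Algebra.ofId ℂ _ := by ext
          rw [this]
          exact (RingHom.finiteType_algebraMap (A := ℂ)
            (B := MvPolynomial (P ⊕ Z) ℂ ⧸ I)).2 inferInstance
        exact AlgHom.FiniteType.of_comp_finiteType h
      exact (RingHom.FinitePresentation.of_finiteType).1 this
    obtain ⟨S, hS⟩ := PrimeSpectrum.exists_constructibleSetData_iff.2
      (PrimeSpectrum.isConstructible_range_comap hfp)
    obtain ⟨q, hq, hq0⟩ := Ideal.exists_comap_eq_of_mem_minimalPrimes_of_injective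
      (f := φ.toRingHom) hφ ⊥ (by simp [IsDomain.minimalPrimes_eq_singleton_bot])
    have hmem : PrimeSpectrum.comap φ.toRingHom ⟨q, hq⟩ ∈ S.toSet := hS ▸ ⟨_, rfl⟩
    simp only [PrimeSpectrum.ConstructibleSetData.toSet, Set.mem_iUnion] at hmem
    obtain ⟨D, hDS, hD⟩ := hmem
    -- The piece `D` is the zero locus of `D.g` minus that of `D.f`. Containing the generic point
    -- forces `D.g = 0` and `D.f ≠ 0`, so `D` is a basic open set.
    have hD0 : D.f ≠ 0 ∧ ∀ i, D.g i = 0 := by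
      simp only [PrimeSpectrum.BasicConstructibleSetData.toSet, Set.mem_sdiff,
        PrimeSpectrum.mem_zeroLocus, PrimeSpectrum.comap_asIdeal, hq0, Set.singleton_subset_iff,
        Set.range_subset_iff, SetLike.mem_coe, Ideal.mem_bot] at hD
      exact ⟨hD.2, hD.1⟩
    refine ⟨D.f, hD0.1, Or.inl fun a ha => ?_⟩
    let ma : Ideal (MvPolynomial P ℂ) := vanishingIdeal ℂ {a}
    have hma : ma.IsMaximal := isMaximal_iff_eq_vanishingIdeal_singleton.2 ⟨a, rfl⟩
    have hmem : (⟨ma, hma.isPrime⟩ : PrimeSpectrum _) ∈ S.toSet := by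
      refine Set.mem_biUnion hDS ?_
      simp only [PrimeSpectrum.BasicConstructibleSetData.toSet, Set.mem_sdiff,
        PrimeSpectrum.mem_zeroLocus, Set.singleton_subset_iff,
        Set.range_subset_iff, SetLike.mem_coe]
      refine ⟨fun i => by rw [hD0.2 i]; exact ma.zero_mem, ?_⟩
      simpa [ma, mem_vanishingIdeal_singleton_iff] using ha
    rw [hS] at hmem
    obtain ⟨⟨r, hr⟩, hr'⟩ := hmem
    have hr'' : r.comap φ.toRingHom = ma := congrArg PrimeSpectrum.asIdeal hr'
    -- A maximal ideal above `r` still contains the image of `ma`. By the Nullstellensatz it is a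
    -- point, whose parameter part is then `a`.
    obtain ⟨M, hM, hrM⟩ := Ideal.exists_le_maximal r hr.ne_top
    have hN : (M.comap (Ideal.Quotient.mk I)).IsMaximal :=
      Ideal.comap_isMaximal_of_surjective _ Ideal.Quotient.mk_surjective
    obtain ⟨x, hx⟩ := isMaximal_iff_eq_vanishingIdeal_singleton.1 hN
    have hxa : ∀ i, x (Sum.inl i) = a i := by
      intro i
      have h1 : (X i - C (a i) : MvPolynomial P ℂ) ∈ ma := by
        simp [ma]
      rw [← hr''] at h1
      have h2 : (X (Sum.inl i) - C (a i) : MvPolynomial (P ⊕ Z) ℂ) ∈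
          M.comap (Ideal.Quotient.mk I) := by
        have := hrM h1
        simpa [φ, Ideal.mem_comap] using this
      rw [hx, mem_vanishingIdeal_singleton_iff] at h2
      simpa [sub_eq_zero] using h2
    refine ⟨fun i => x (Sum.inr i), fun j => ?_⟩
    have : Sum.elim a (fun i => x (Sum.inr i)) = x := by
      ext (i | i)
      · exact (hxa i).symm
      · rfl
    rw [this]
    have h3 : f j ∈ M.comap (Ideal.Quotient.mk I) := by
      have h4 : Ideal.Quotient.mk I (f j) = 0 :=
        Ideal.Quotient.eq_zero_iff_mem.2 (Ideal.subset_span ⟨j, rfl⟩)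
      rw [Ideal.mem_comap, h4]
      exact M.zero_mem
    rw [hx, mem_vanishingIdeal_singleton_iff] at h3
    simpa using h3
  -- Otherwise elimination yields a nonzero polynomial in the parameters alone that lies in `I`; it
  -- vanishes wherever the system is solvable.
  · rw [injective_iff_map_eq_zero] at hφ
    push Not at hφ
    obtain ⟨Q, hQ, hQ0⟩ := hφ
    refine ⟨Q, hQ0, Or.inr fun a ha => ?_⟩
    rintro ⟨z, hz⟩
    have h1 : rename Sum.inl Q ∈ I := by
      simpa [φ, Ideal.Quotient.eq_zero_iff_mem] using hQ
    have h2 : I ≤ RingHom.ker (eval (Sum.elim a z)) := by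
      rw [hI, Ideal.span_le]
      rintro _ ⟨j, rfl⟩
      exact hz j
    have h3 := h2 h1
    rw [RingHom.mem_ker, eval_rename] at h3
    exact ha h3

/-- The version of `exists_generic_dichotomy` for solutions with nonzero coordinates. -/
theorem exists_generic_dichotomy_torus [Finite P] [Fintype Z]
    (f : J → MvPolynomial (P ⊕ Z) ℂ) :
    ∃ Q : MvPolynomial P ℂ, Q ≠ 0 ∧
      ((∀ a, eval a Q ≠ 0 → ∃ z, (∀ i, z i ≠ 0) ∧ ∀ j, eval (Sum.elim a z) (f j) = 0) ∨
        ∀ a, eval a Q ≠ 0 → ¬ ∃ z, (∀ i, z i ≠ 0) ∧ ∀ j, eval (Sum.elim a z) (f j) = 0) := by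
  -- Rabinowitsch's trick: the extra variable `none` is an inverse of the product of all
  -- coordinates.
  let g : Option J → MvPolynomial (P ⊕ Option Z) ℂ := fun j =>
    j.elim (X (Sum.inr none) * ∏ i, X (Sum.inr (some i)) - 1)
      (fun j => rename (Sum.map id some) (f j))
  have key : ∀ a, (∃ z, ∀ j, eval (Sum.elim a z) (g j) = 0) ↔
      ∃ z, (∀ i, z i ≠ 0) ∧ ∀ j, eval (Sum.elim a z) (f j) = 0 := by
    intro a
    constructor
    · rintro ⟨z, hz⟩
      refine ⟨fun i => z (some i), fun i hi => ?_, fun j => ?_⟩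
      · have h := hz none
        simp only [g, Option.elim, map_sub, map_mul, eval_X, Sum.elim_inr, map_prod, map_one] at h
        rw [Finset.prod_eq_zero (Finset.mem_univ i) hi] at h
        simp at h
      · have h := hz (some j)
        simp only [g, Option.elim, eval_rename] at h
        convert h using 2
        congr 1
        ext (i | i) <;> rfl
    · rintro ⟨z, hz0, hz⟩
      refine ⟨fun i => i.elim (∏ i, z i)⁻¹ z, ?_⟩
      rintro (_ | j)
      · simp [g, inv_mul_cancel₀ (Finset.prod_ne_zero_iff.2 fun i _ => hz0 i)]
      · have h := hz j
        simp only [g, Option.elim, eval_rename]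
        convert h using 2
        congr 1
        ext (i | i) <;> rfl
  simpa only [key] using exists_generic_dichotomy g

/-- Polynomials in fewer variables than polynomials: the image of a hypersurface is contained in
a hypersurface. -/
theorem exists_vanishing_on_image [Fintype P] [Fintype Z]
    (f : P → MvPolynomial Z ℂ) (g : MvPolynomial Z ℂ) (hg : g ≠ 0)
    (hcard : Fintype.card Z ≤ Fintype.card P) :
    ∃ Q : MvPolynomial P ℂ, Q ≠ 0 ∧
      ∀ z, eval z g = 0 → eval (fun i => eval z (f i)) Q = 0 := by
  -- These are more polynomials than variables, hence algebraically dependent.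
  let F : Option P → MvPolynomial Z ℂ := fun o => o.elim g f
  have hF : ¬ AlgebraicIndependent ℂ F := by
    intro h
    have := h.lift_cardinalMk_le_trdeg
    simp at this
    omega
  rw [algebraicIndependent_iff] at hF
  push Not at hF
  obtain ⟨R, hR, hR0⟩ := hF
  let e := optionEquivLeft ℂ P
  -- In the relation, seen as a polynomial in the variable standing for `g`, the largest power of
  -- that variable is split off. As `g ≠ 0`, the cofactor `T` is still a relation; its constant
  -- coefficient is nonzero and is what remains of `T` where `g` vanishes.
  obtain ⟨k, T, hT, hTX⟩ : ∃ (k : ℕ) (T : Polynomial (MvPolynomial P ℂ)),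
      e R = Polynomial.X ^ k * T ∧ ¬ (Polynomial.X ∣ T) := by
    have hfin : FiniteMultiplicity (Polynomial.X : Polynomial (MvPolynomial P ℂ)) (e R) := by
      refine FiniteMultiplicity.of_prime_left Polynomial.prime_X ?_
      simpa using hR0
    obtain ⟨T, hT, hT'⟩ := hfin.exists_eq_pow_mul_and_not_dvd
    exact ⟨_, T, hT, hT'⟩
  have hval : ∀ S : Polynomial (MvPolynomial P ℂ),
      aeval F (e.symm S) = S.eval₂ (aeval f).toRingHom g := by
    intro S
    have : (aeval F).toRingHom.comp e.symm.toAlgHom.toRingHom =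
        Polynomial.eval₂RingHom (aeval f).toRingHom g := by
      apply Polynomial.ringHom_ext'
      · ext i
        · simp [e]
        · simp [e, F]
      · simp [e, F]
    exact DFunLike.congr_fun this S
  have hT0 : T.eval₂ (aeval f).toRingHom g = 0 := by
    have h := hval (e R)
    rw [AlgEquiv.symm_apply_apply, hR, hT, Polynomial.eval₂_mul, Polynomial.eval₂_X_pow] at h
    exact (mul_eq_zero.1 h.symm).resolve_left (pow_ne_zero _ hg)
  refine ⟨T.coeff 0, fun h => hTX (Polynomial.X_dvd_iff.2 h), fun z hz => ?_⟩
  have h1 := congrArg (eval z) hT0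
  rw [Polynomial.hom_eval₂, map_zero, hz, Polynomial.eval₂_at_zero] at h1
  rw [← h1]
  rw [AlgHom.toRingHom_eq_coe, RingHom.comp_apply, RingHom.coe_coe, aeval_eq_bind₁]
  exact (eval₂Hom_bind₁ (RingHom.id ℂ) z f _).symm

end Generic

end SphereEquations

namespace SphereEquations

/-! ### Rigidity bounds the number of edges from below -/

section RigidityCount

open MvPolynomial Topology

/-- In `ℝ^d`, finitely many points have prescribed distances to `d` affinely independent points. -/
theorem finite_setOf_dist_eq {ι : Type*} [Fintype ι] {d : ℕ} (q : ι → EuclideanSpace ℝ (Fin d))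
    (q₀ : EuclideanSpace ℝ (Fin d)) (hq : LinearIndependent ℝ fun i => q i - q₀)
    (hcard : Fintype.card ι + 1 = d) (c : ι → ℝ) (c₀ : ℝ) :
    {x | dist x q₀ = c₀ ∧ ∀ i, dist x (q i) = c i}.Finite := by
  set S := {x | dist x q₀ = c₀ ∧ ∀ i, dist x (q i) = c i}
  rcases S.eq_empty_or_nonempty with hS | ⟨y, hy0, hy⟩
  · rw [hS]; exact Set.finite_empty
  set W := Submodule.span ℝ (Set.range fun i => q i - q₀)
  have hW : Module.finrank ℝ W = Fintype.card ι := finrank_span_eq_card hq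
  have hW' : Module.finrank ℝ Wᗮ = 1 := by
    have := W.finrank_add_finrank_orthogonal
    rw [finrank_euclideanSpace_fin] at this
    omega
  obtain ⟨n, hn0, hn⟩ := finrank_eq_one_iff'.1 hW'
  -- The only other candidate is the mirror image of `y` in the affine hyperplane through the given
  -- points, whose normal is `n`.
  refine Set.Finite.subset (s := {y, y + (-(2 * inner ℝ (y - q₀) (n : EuclideanSpace ℝ (Fin d))) /
    ‖(n : EuclideanSpace ℝ (Fin d))‖ ^ 2) • (n : EuclideanSpace ℝ (Fin d))}) (by simp) ?_
  rintro x ⟨hx0, hx⟩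
  -- Subtracting the squared-distance equations for `q₀` from those for `q i` cancels the squared
  -- norms of `x` and `y` and leaves linear equations.
  have hmem : x - y ∈ Wᗮ := by
    rw [Submodule.mem_orthogonal]
    intro u hu
    induction hu using Submodule.span_induction with
    | zero => simp
    | add a b _ _ ha hb => rw [inner_add_left, ha, hb, add_zero]
    | smul r a _ ha => rw [inner_smul_left, ha, mul_zero]
    | mem a ha =>
      obtain ⟨i, rfl⟩ := ha
      have e1 : ‖x - q i‖ ^ 2 = ‖y - q i‖ ^ 2 := by
        rw [← dist_eq_norm, ← dist_eq_norm, hx i, hy i]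
      have e2 : ‖x - q₀‖ ^ 2 = ‖y - q₀‖ ^ 2 := by
        rw [← dist_eq_norm, ← dist_eq_norm, hx0, hy0]
      rw [@norm_sub_sq_real, @norm_sub_sq_real] at e1 e2
      rw [inner_sub_left, inner_sub_right, inner_sub_right, real_inner_comm x, real_inner_comm y,
        real_inner_comm x, real_inner_comm y]
      linarith
  obtain ⟨t, ht⟩ := hn ⟨x - y, hmem⟩
  have ht' : x = y + t • (n : EuclideanSpace ℝ (Fin d)) := by
    have := congrArg Subtype.val ht
    simp only [SetLike.val_smul] at this
    rw [this]; abel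
  have e2 : ‖x - q₀‖ ^ 2 = ‖y - q₀‖ ^ 2 := by
    rw [← dist_eq_norm, ← dist_eq_norm, hx0, hy0]
  have hnn : ‖(n : EuclideanSpace ℝ (Fin d))‖ ^ 2 ≠ 0 := by
    have : (n : EuclideanSpace ℝ (Fin d)) ≠ 0 := by simpa using hn0
    positivity
  rw [ht', show y + t • (n : EuclideanSpace ℝ (Fin d)) - q₀ = (y - q₀) + t • (n : _) by abel,
    @norm_add_sq_real, inner_smul_right, norm_smul, mul_pow, Real.norm_eq_abs, sq_abs] at e2
  have e3 : t * (2 * inner ℝ (y - q₀) (n : EuclideanSpace ℝ (Fin d)) +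
      t * ‖(n : EuclideanSpace ℝ (Fin d))‖ ^ 2) = 0 := by linarith
  rcases mul_eq_zero.1 e3 with h | h
  · left; rw [ht', h]; simp
  · right
    rw [Set.mem_singleton_iff, ht']
    congr 2
    rw [eq_div_iff hnn]
    linarith

/-- An open set contains a cube, and a polynomial that vanishes on a product of infinite sets is
zero. -/
theorem exists_mem_eval_ne_zero {σ : Type*} [Fintype σ] {f : MvPolynomial σ ℝ} (hf : f ≠ 0)
    {O : Set (σ → ℝ)} (hO : IsOpen O) (hne : O.Nonempty) : ∃ x ∈ O, eval x f ≠ 0 := by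
  obtain ⟨x, hx⟩ := hne
  obtain ⟨ε, hε, hball⟩ := Metric.isOpen_iff.1 hO x hx
  by_contra! h
  apply hf
  refine funext_set (fun i => Metric.ball (x i) ε)
    (fun i => infinite_of_mem_nhds (x i) (Metric.ball_mem_nhds _ hε)) fun y hy => ?_
  rw [map_zero]
  apply h y (hball _)
  rwa [ball_pi _ hε]

variable {V : Type*} [DecidableEq V] (G : SimpleGraph V) (K : Finset V) {d : ℕ}

/-- The extension by zero of a family on the free vertices. -/
def extendZero {R : Type*} [Zero R] (ξ : FreeVertex K × Fin d → R) (a : V × Fin d) : R :=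
  if h : a.1 ∈ K then 0 else ξ (⟨a.1, h⟩, a.2)

/-- The points with coordinate vector `x`. -/
def toPoints {V : Type*} (x : V × Fin d → ℝ) (v : V) : EuclideanSpace ℝ (Fin d) :=
  WithLp.toLp 2 fun k => x (v, k)

theorem dist_toPoints_sq {V : Type*} (x : V × Fin d → ℝ) (u v : V) :
    dist (toPoints x u) (toPoints x v) ^ 2 = ∑ k, (x (u, k) - x (v, k)) ^ 2 := by
  rw [EuclideanSpace.dist_eq, Real.sq_sqrt (Finset.sum_nonneg fun _ _ => sq_nonneg _)]
  simp [toPoints, Real.dist_eq, sq_abs]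

/-- A polynomial vector field that moves the free vertices and preserves the edge lengths
infinitesimally integrates to a flex. -/
theorem not_isRigidEmbedding_of_field [Fintype V] (ξ : FreeVertex K × Fin d → MvPolynomial (V × Fin d) ℝ)
    (hξ : ∀ u v, G.Adj u v → (u ∉ K ∨ v ∉ K) →
      ∑ k, (X (u, k) - X (v, k)) * (extendZero K ξ (u, k) - extendZero K ξ (v, k)) = 0)
    (x : V × Fin d → ℝ) (a : FreeVertex K × Fin d) (ha : eval x (ξ a) ≠ 0)
    (v₀ : V) (hv₀ : v₀ ∈ K) (hcard : K.card = d)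
    (hx : LinearIndependent ℝ fun v : {v // v ∈ K.erase v₀} => toPoints x v - toPoints x v₀) :
    ¬ IsRigidEmbedding G (toPoints x) := by
  rintro ⟨T, hT, hrig⟩
  let F : (V × Fin d → ℝ) → (V × Fin d → ℝ) := fun y b => eval y (extendZero K ξ b)
  have hF : ContDiff ℝ 1 F := by
    rw [contDiff_pi]
    intro b
    have : ContDiff ℝ 1 fun y : V × Fin d → ℝ => aeval (R := ℝ) y (extendZero K ξ b) := by
      induction extendZero K ξ b using MvPolynomial.induction_on with
      | C r => simpa using contDiff_const
      | add p q hp hq => simpa using hp.add hq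
      | mul_X p i hp => simpa using hp.mul (contDiff_apply ℝ ℝ i)
    simpa [F, coe_aeval_eq_eval] using this
  -- Picard–Lindelöf gives the integral curve through `x`. The field vanishes on `K`, so the points
  -- of `K` stay put; the edge lengths have derivative zero along the curve.
  obtain ⟨α, hα0, ε, hε, hα⟩ :=
    hF.contDiffAt (x := x).exists_forall_mem_closedBall_exists_eq_forall_mem_Ioo_hasDerivAt₀ 0
  set s := Set.Ioo (0 - ε) (0 + ε)
  have h0s : (0 : ℝ) ∈ s := by constructor <;> linarith
  have hα' : ∀ t ∈ s, ∀ b, HasDerivAt (fun t => α t b) (F (α t) b) t :=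
    fun t ht b => (hasDerivAt_pi.1 (hα t ht)) b
  have hconst : ∀ g g' : ℝ → ℝ, (∀ t ∈ s, HasDerivAt g (g' t) t) → (∀ t ∈ s, g' t = 0) →
      ∀ t ∈ s, g t = g 0 := by
    intro g g' hg hg' t ht
    refine isOpen_Ioo.is_const_of_deriv_eq_zero isPreconnected_Ioo
      (fun t ht => (hg t ht).differentiableAt.differentiableWithinAt) (fun t ht => ?_) ht h0s
    rw [(hg t ht).deriv, hg' t ht]; rfl
  have hK : ∀ v ∈ K, ∀ t ∈ s, toPoints (α t) v = toPoints x v := by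
    intro v hv t ht
    have : ∀ k, α t (v, k) = x (v, k) := by
      intro k
      rw [hconst _ _ (fun t ht => hα' t ht (v, k)) (fun t ht => ?_) t ht, hα0]
      simp [F, extendZero, hv]
    simp [toPoints, this]
  have hedge : ∀ t ∈ s, SameEdgeLengths G (toPoints x) (toPoints (α t)) := by
    intro t ht u v huv
    by_cases hfree : u ∉ K ∨ v ∉ K
    · have h1 : ∑ k, (α t (u, k) - α t (v, k)) ^ 2 = ∑ k, (α 0 (u, k) - α 0 (v, k)) ^ 2 := by
        refine hconst (fun t => ∑ k, (α t (u, k) - α t (v, k)) ^ 2)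
          (fun t => ∑ k, (2 * (α t (u, k) - α t (v, k)) * (F (α t) (u, k) - F (α t) (v, k))))
          (fun t ht => ?_) (fun t ht => ?_) t ht
        · refine HasDerivAt.fun_sum fun k _ => ?_
          have h := ((hα' t ht (u, k)).fun_sub (hα' t ht (v, k))).fun_pow 2
          simp only [Nat.cast_ofNat, Nat.add_one_sub_one, pow_one] at h
          exact h
        · have := congrArg (eval (α t)) (hξ u v huv hfree)
          simp only [map_sum, map_mul, map_sub, eval_X, map_zero] at this
          simp only [mul_assoc, ← Finset.mul_sum]
          rw [this, mul_zero]
      rw [hα0, ← dist_toPoints_sq, ← dist_toPoints_sq] at h1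
      exact (sq_eq_sq₀ dist_nonneg dist_nonneg).1 h1
    · push Not at hfree
      rw [hK u hfree.1 t ht, hK v hfree.2 t ht]
  -- If finitely many `r` represented all congruence classes, the vertex `a.1` would have finitely
  -- many possible lists of distances to the fixed points of `K`, hence finitely many positions.
  have hfin : (⋃ r ∈ T, {y | dist y (toPoints x v₀) = dist (r a.1) (r v₀) ∧
      ∀ v : {v // v ∈ K.erase v₀}, dist y (toPoints x v) = dist (r a.1) (r v)}).Finite := by
    refine hT.biUnion fun r _ => finite_setOf_dist_eq _ _ hx ?_ _ _
    rw [Fintype.card_coe, Finset.card_erase_of_mem hv₀]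
    have := Finset.card_pos.2 ⟨v₀, hv₀⟩
    omega
  have hin : ∀ t ∈ s, toPoints (α t) a.1 ∈ ⋃ r ∈ T,
      {y | dist y (toPoints x v₀) = dist (r a.1) (r v₀) ∧
      ∀ v : {v // v ∈ K.erase v₀}, dist y (toPoints x v) = dist (r a.1) (r v)} := by
    intro t ht
    obtain ⟨r, hr, g, hg⟩ := hrig _ (hedge t ht)
    have : ∀ v ∈ K, dist (toPoints (α t) a.1) (toPoints x v) = dist (r a.1) (r v) := by
      intro v hv
      rw [← hK v hv t ht, hg, hg, g.dist_eq]
    refine Set.mem_biUnion hr ⟨this v₀ hv₀, fun v => this v (Finset.mem_of_mem_erase v.2)⟩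
  have hfin' := hfin.image fun y : EuclideanSpace ℝ (Fin d) => y a.2
  -- The coordinate `a` has nonzero derivative at time 0, so for small nonzero times it avoids any
  -- given finite set of values.
  have hne : ∀ᶠ t in 𝓝[≠] (0 : ℝ), ∀ c ∈ ((fun y : EuclideanSpace ℝ (Fin d) => y a.2) '' ⋃ r ∈ T,
      {y | dist y (toPoints x v₀) = dist (r a.1) (r v₀) ∧
      ∀ v : {v // v ∈ K.erase v₀}, dist y (toPoints x v) = dist (r a.1) (r v)}),
      α t (a.1, a.2) ≠ c := by
    rw [Filter.eventually_all_finite hfin']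
    intro c _
    refine (hα' 0 h0s (a.1, a.2)).eventually_ne ?_
    rw [hα0]
    simpa [F, extendZero, a.1.2] using ha
  have hs : ∀ᶠ t in 𝓝[≠] (0 : ℝ), t ∈ s :=
    nhdsWithin_le_nhds (isOpen_Ioo.mem_nhds h0s)
  obtain ⟨t, ht1, ht2⟩ := (hne.and hs).exists
  exact ht1 _ ⟨_, hin t ht2, rfl⟩ rfl

/-- The witness puts `v₀` at the origin and the other `d - 1` points of `K` at distinct standard
basis vectors. -/
theorem exists_linearIndependent_toPoints (v₀ : V) (hv₀ : v₀ ∈ K) (hcard : K.card = d) :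
    ∃ x : V × Fin d → ℝ, LinearIndependent ℝ
      fun v : {v // v ∈ K.erase v₀} => toPoints x v - toPoints x v₀ := by
  obtain ⟨e⟩ : Nonempty ({v // v ∈ K.erase v₀} ↪ Fin d) := by
    apply Function.Embedding.nonempty_of_card_le
    rw [Fintype.card_coe, Fintype.card_fin, Finset.card_erase_of_mem hv₀]
    omega
  refine ⟨fun a => if h : a.1 ∈ K.erase v₀ then if e ⟨a.1, h⟩ = a.2 then 1 else 0 else 0, ?_⟩
  have hb := ((EuclideanSpace.basisFun (Fin d) ℝ).toBasis.linearIndependent).comp e e.injective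
  have heq : ∀ v : {v // v ∈ K.erase v₀}, toPoints (fun a : V × Fin d =>
      if h : a.1 ∈ K.erase v₀ then if e ⟨a.1, h⟩ = a.2 then (1 : ℝ) else 0 else 0) v -
      toPoints (fun a : V × Fin d =>
      if h : a.1 ∈ K.erase v₀ then if e ⟨a.1, h⟩ = a.2 then (1 : ℝ) else 0 else 0) v₀ =
      (EuclideanSpace.basisFun (Fin d) ℝ).toBasis (e v) := by
    intro v
    ext k
    simp [toPoints, eq_comm]
  simp only [heq]
  exact hb

/-- A generically rigid graph has at least as many free edges as there are coordinates of free
vertices, when `d` vertices are fixed. -/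
theorem GenericallyRigid.card_le [Fintype V] (hG : GenericallyRigid G d) (hcard : K.card = d) (hd : 0 < d) :
    Fintype.card (FreeVertex K × Fin d) ≤ Fintype.card (FreeEdge G K) := by
  by_contra hlt
  obtain ⟨v₀, hv₀⟩ : K.Nonempty := Finset.card_pos.1 (hcard ▸ hd)
  -- This is the rigidity matrix with indeterminate positions, without the columns of `K`. With more
  -- columns than rows it has a nonzero polynomial kernel vector. `Quot.out` orients each edge; the
  -- entries are symmetric in the two ends.
  let Φ : (FreeVertex K × Fin d → MvPolynomial (V × Fin d) ℝ) →ₗ[MvPolynomial (V × Fin d) ℝ]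
      (FreeEdge G K → MvPolynomial (V × Fin d) ℝ) :=
    { toFun := fun ξ e => ∑ k, (X ((Quot.out e.1).1, k) - X ((Quot.out e.1).2, k)) *
        (extendZero K ξ ((Quot.out e.1).1, k) - extendZero K ξ ((Quot.out e.1).2, k))
      map_add' := by
        intro ξ η
        ext1 e
        rw [Pi.add_apply, ← Finset.sum_add_distrib]
        refine Finset.sum_congr rfl fun k _ => ?_
        simp only [extendZero]
        split_ifs <;> simp <;> ring
      map_smul' := by
        intro r ξ
        ext1 e
        rw [RingHom.id_apply, Pi.smul_apply, Finset.smul_sum]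
        refine Finset.sum_congr rfl fun k _ => ?_
        simp only [extendZero]
        split_ifs <;> simp <;> ring }
  have hΦ : ¬ Function.Injective Φ := fun h => hlt (_root_.card_le_of_injective _ Φ h)
  rw [injective_iff_map_eq_zero] at hΦ
  push Not at hΦ
  obtain ⟨ξ, hξ, hξ0⟩ := hΦ
  obtain ⟨a, ha⟩ := Function.ne_iff.1 hξ0
  have hfield : ∀ u v, G.Adj u v → (u ∉ K ∨ v ∉ K) →
      ∑ k, (X (u, k) - X (v, k)) * (extendZero K ξ (u, k) - extendZero K ξ (v, k)) = 0 := by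
    intro u v huv hfree
    have h := congrFun hξ ⟨s(u, v), huv, by
      rcases hfree with h | h
      · exact ⟨u, by simp, h⟩
      · exact ⟨v, by simp, h⟩⟩
    simp only [Φ, LinearMap.coe_mk, AddHom.coe_mk, Pi.zero_apply] at h
    have hout : s((Quot.out s(u, v)).1, (Quot.out s(u, v)).2) = s(u, v) := Quot.out_eq _
    rcases Sym2.eq_iff.1 hout with ⟨h1, h2⟩ | ⟨h1, h2⟩
    · rwa [h1, h2] at h
    · rw [h1, h2] at h
      rw [← h]
      exact Finset.sum_congr rfl fun k _ => by ring
  have hO : IsOpen {x : V × Fin d → ℝ | LinearIndependent ℝ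
      fun v : {v // v ∈ K.erase v₀} => toPoints x v - toPoints x v₀} := by
    refine isOpen_setOfPred_linearIndependent.preimage
      (f := fun (x : V × Fin d → ℝ) (v : {v // v ∈ K.erase v₀}) =>
        toPoints x v - toPoints x v₀) ?_
    unfold toPoints
    fun_prop
  obtain ⟨x, hxO, hxa⟩ := exists_mem_eval_ne_zero ha hO
    (exists_linearIndependent_toPoints K v₀ hv₀ hcard)
  -- Flexibility on a whole neighbourhood makes the embedding generic, which contradicts generic
  -- rigidity.
  have hflex : ∀ᶠ y in 𝓝 x, ¬ IsRigidEmbedding G (toPoints y) := by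
    have h1 : ∀ᶠ y in 𝓝 x, eval y (ξ a) ≠ 0 :=
      (MvPolynomial.continuous_eval (ξ a)).continuousAt.eventually_ne hxa
    filter_upwards [hO.mem_nhds hxO, h1] with y hy hya
    exact not_isRigidEmbedding_of_field G K ξ hfield y a hya v₀ hv₀ hcard hy
  have hflex' : ∀ᶠ q in 𝓝 (toPoints x), ¬ IsRigidEmbedding G q := by
    let c : (V → EuclideanSpace ℝ (Fin d)) → (V × Fin d → ℝ) := fun q b => q b.1 b.2
    have hc : Continuous c := by fun_prop
    have hcx : c (toPoints x) = x := by ext; simp [c, toPoints]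
    have := hc.continuousAt.tendsto (x := toPoints x)
    rw [hcx] at this
    filter_upwards [this.eventually hflex] with q hq
    rwa [show toPoints (c q) = q from rfl] at hq
  have hx : ¬ IsRigidEmbedding G (toPoints x) := hflex.self_of_nhds
  refine hx (hG _ ?_)
  filter_upwards [hflex'] with q hq
  exact iff_of_false hq hx

end RigidityCount

end SphereEquations

namespace SphereEquations

/-! ### Facets of a product of simplices -/

section FacetNormals

set_option linter.unusedSectionVars false

variable {U I : Type*} [Fintype U] [DecidableEq U] [Fintype I] [DecidableEq I]

/-- The product of the scaled simplices `c u • T^u`, in terms of inequalities. -/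
def simplexProduct (c : U → ℝ) : Set (U × I → ℝ) :=
  {x | (∀ a, 0 ≤ x a) ∧ ∀ u, ∑ i, x (u, i) ≤ c u}

theorem mem_blockSimplex (u : U) (x : U × I → ℝ) :
    x ∈ blockSimplex u ↔ (∀ a, 0 ≤ x a) ∧ (∀ a, a.1 ≠ u → x a = 0) ∧ ∑ i, x (u, i) ≤ 1 := by
  constructor
  · intro h
    have hconv : Convex ℝ {x : U × I → ℝ |
        (∀ a, 0 ≤ x a) ∧ (∀ a, a.1 ≠ u → x a = 0) ∧ ∑ i, x (u, i) ≤ 1} := by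
      rintro x ⟨hx1, hx2, hx3⟩ y ⟨hy1, hy2, hy3⟩ s t hs ht hst
      refine ⟨fun a => ?_, fun a ha => ?_, ?_⟩
      · have := hx1 a; have := hy1 a
        simp only [Pi.add_apply, Pi.smul_apply, smul_eq_mul]
        positivity
      · simp [hx2 a ha, hy2 a ha]
      · simp only [Pi.add_apply, Pi.smul_apply, smul_eq_mul, Finset.sum_add_distrib,
          ← Finset.mul_sum]
        nlinarith
    refine convexHull_min ?_ hconv h
    rintro y (rfl | ⟨i, rfl⟩)
    · simp
    · refine ⟨fun a => ?_, fun a ha => ?_, ?_⟩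
      · simp only [Pi.single_apply]; split_ifs <;> norm_num
      · simp only [Pi.single_apply]; rw [if_neg]; rintro rfl; exact ha rfl
      · simp [Pi.single_apply]
  · rintro ⟨h1, h2, h3⟩
    have hx : x = ∑ o : Option I, (o.elim (1 - ∑ i, x (u, i)) fun i => x (u, i)) •
        (o.elim 0 fun i => Pi.single (u, i) (1 : ℝ) : U × I → ℝ) := by
      ext a
      simp only [Fintype.sum_option, Option.elim, Finset.sum_apply, Pi.zero_apply,
        Pi.smul_apply, smul_eq_mul, Pi.single_apply, mul_ite, mul_one, mul_zero, zero_add]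
      by_cases ha : a.1 = u
      · obtain ⟨v, i⟩ := a
        subst ha
        simp
      · rw [h2 a ha, Finset.sum_eq_zero]
        intro i _
        rw [if_neg]
        rintro rfl
        exact ha rfl
    rw [hx]
    refine (convex_convexHull ℝ _).sum_mem ?_ ?_ ?_
    · rintro (_ | i) _
      · simpa using h3
      · exact h1 _
    · simp [Fintype.sum_option]
    · rintro (_ | i) _
      · exact subset_convexHull ℝ _ (Set.mem_insert _ _)
      · exact subset_convexHull ℝ _ (Set.mem_insert_of_mem _ ⟨i, rfl⟩)

/-- The simplices live in complementary coordinate blocks, so their Minkowski sum is a product.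
Positivity of `c` allows rescaling each factor back to the unit simplex. -/
theorem sum_smul_blockSimplex (c : U → ℝ) (hc : ∀ u, 0 < c u) :
    ∑ u, c u • (blockSimplex u : Set (U × I → ℝ)) = simplexProduct c := by
  ext x
  rw [Set.mem_fintype_sum]
  constructor
  · rintro ⟨g, hg, rfl⟩
    have hg' : ∀ v, ∃ y ∈ (blockSimplex v : Set (U × I → ℝ)), c v • y = g v :=
      fun v => Set.mem_smul_set.1 (hg v)
    choose y hy hyg using hg'
    have hsum : ∀ a : U × I, (∑ v, g v) a = c a.1 * y a.1 a := by
      intro a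
      rw [Finset.sum_apply, Finset.sum_eq_single a.1]
      · rw [← hyg]; rfl
      · intro v _ hv
        rw [← hyg, Pi.smul_apply, ((mem_blockSimplex v _).1 (hy v)).2.1 a hv.symm, smul_zero]
      · simp
    refine ⟨fun a => ?_, fun u => ?_⟩
    · rw [hsum]
      exact mul_nonneg (hc _).le (((mem_blockSimplex _ _).1 (hy _)).1 a)
    · simp only [hsum, ← Finset.mul_sum]
      exact mul_le_of_le_one_right (hc u).le ((mem_blockSimplex _ _).1 (hy u)).2.2
  · rintro ⟨h1, h2⟩
    refine ⟨fun u a => if a.1 = u then x a else 0, fun u => ?_, ?_⟩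
    · refine Set.mem_smul_set.2 ⟨fun a => if a.1 = u then (c u)⁻¹ * x a else 0,
        (mem_blockSimplex _ _).2 ⟨fun a => ?_, fun a ha => if_neg ha, ?_⟩, ?_⟩
      · split_ifs
        · exact mul_nonneg (inv_nonneg.2 (hc u).le) (h1 a)
        · exact le_rfl
      · simp only [if_true, ← Finset.mul_sum]
        rw [inv_mul_le_iff₀ (hc u), mul_one]
        exact h2 u
      · ext a
        simp only [Pi.smul_apply, smul_eq_mul, mul_ite, mul_zero]
        rw [mul_inv_cancel_left₀ (hc u).ne']
    · ext a
      simp [Finset.sum_apply]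

/-- For each block, the multiples of the convex set `blockSimplex u` add up to the multiple by the
total degree. -/
theorem mBezoutSum_eq {J : Type*} [Fintype J] (F : J → MvPolynomial (U × I) ℂ)
    (hF : ∀ u, 0 < ∑ j, blockDegree u (F j)) :
    mBezoutSum F = simplexProduct fun u => ((∑ j, blockDegree u (F j) : ℕ) : ℝ) := by
  rw [← sum_smul_blockSimplex _ fun u => by exact_mod_cast hF u]
  unfold mBezoutSum mBezoutPolytope
  rw [Finset.sum_comm]
  refine Finset.sum_congr rfl fun u _ => ?_
  generalize (Finset.univ : Finset J) = s
  classical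
  induction s using Finset.induction_on with
  | empty =>
    rw [Finset.sum_empty, Finset.sum_empty, Nat.cast_zero, Set.zero_smul_set]
    exact ⟨0, subset_convexHull ℝ _ (Set.mem_insert _ _)⟩
  | insert j s hj ih =>
    have hconv : Convex ℝ (blockSimplex u : Set (U × I → ℝ)) := convex_convexHull ℝ _
    rw [Finset.sum_insert hj, Finset.sum_insert hj, ih, Nat.cast_add,
      hconv.add_smul (Nat.cast_nonneg _) (Nat.cast_nonneg _)]

/-- The inner normal of the facet of `simplexProduct c` on which a coordinate vanishes. -/
def coordNormal (a : U × I) : U × I → ℤ := Pi.single a 1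

/-- The inner normal of the facet of `simplexProduct c` on which the sum of a block is maximal. -/
def blockNormal (u : U) (a : U × I) : ℤ := if a.1 = u then -1 else 0

theorem dotProduct_coordNormal (a : U × I) (x : U × I → ℝ) :
    x ⬝ᵥ (fun b => ((coordNormal a b : ℤ) : ℝ)) = x a := by
  simp [dotProduct, coordNormal, Pi.single_apply]

theorem dotProduct_blockNormal (u : U) (x : U × I → ℝ) :
    x ⬝ᵥ (fun b => ((blockNormal u b : ℤ) : ℝ)) = - ∑ i, x (u, i) := by
  simp only [dotProduct, blockNormal, Fintype.sum_prod_type, Int.cast_ite, Int.cast_neg,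
    Int.cast_one, Int.cast_zero, mul_ite, mul_neg, mul_one, mul_zero]
  rw [Finset.sum_eq_single u]
  · simp
  · intro v _ hv
    simp [hv]
  · simp

theorem gcd_univ_eq_one {σ : Type*} [Fintype σ] (w : σ → ℤ) (a : σ) (ha : IsUnit (w a)) :
    Finset.univ.gcd w = 1 := by
  rw [← Finset.normalize_gcd, normalize_eq_one]
  exact isUnit_of_dvd_unit (Finset.gcd_dvd (Finset.mem_univ a)) ha

theorem finrank_ker_dotProduct {σ : Type*} [Fintype σ] {w : σ → ℝ} (hw : w ≠ 0) :
    Module.finrank ℝ (LinearMap.ker (dotProductBilin ℝ ℝ w)) + 1 = Fintype.card σ := by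
  rw [Module.Dual.finrank_ker_add_one_of_ne_zero, Module.finrank_fintype_fun_eq_card]
  intro h
  exact hw (dotProduct_self_eq_zero.1 (LinearMap.congr_fun h w))

theorem vectorSpan_le_ker_dotProduct {σ : Type*} [Fintype σ] (F : Set (σ → ℝ)) (v : σ → ℝ)
    (m : ℝ) (h : ∀ x ∈ F, x ⬝ᵥ v = m) :
    vectorSpan ℝ F ≤ LinearMap.ker (dotProductBilin ℝ ℝ v) := by
  rw [vectorSpan_def, Submodule.span_le]
  rintro _ ⟨x, hx, y, hy, rfl⟩
  rw [SetLike.mem_coe, LinearMap.mem_ker]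
  change v ⬝ᵥ (x - y) = 0
  rw [dotProduct_sub, dotProduct_comm v, dotProduct_comm v, h x hx, h y hy, sub_self]

/-- If a point of the minimal face of `P` in direction `w` can be moved within `P` along every
direction orthogonal to `w`, then this face is a facet. -/
theorem finrank_vectorSpan_minFace {σ : Type*} [Fintype σ] (P : Set (σ → ℝ)) (w : σ → ℝ)
    (hw : w ≠ 0) (x : σ → ℝ) (hx : x ∈ minFace P w)
    (h : ∀ z, z ⬝ᵥ w = 0 → ∃ ε : ℝ, ε ≠ 0 ∧ x + ε • z ∈ P) :
    Module.finrank ℝ (vectorSpan ℝ (minFace P w)) + 1 = Fintype.card σ := by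
  rw [← finrank_ker_dotProduct hw]
  suffices h' : vectorSpan ℝ (minFace P w) = LinearMap.ker (dotProductBilin ℝ ℝ w) by rw [h']
  refine le_antisymm ?_ ?_
  · exact vectorSpan_le_ker_dotProduct _ _ (x ⬝ᵥ w)
      fun y hy => le_antisymm (hy.2 x hx.1) (hx.2 y hy.1)
  · intro z hz
    have hz' : z ⬝ᵥ w = 0 := by rw [dotProduct_comm]; exact hz
    obtain ⟨ε, hε, hεP⟩ := h z hz'
    have hmem : x + ε • z ∈ minFace P w := by
      refine ⟨hεP, fun y hy => ?_⟩
      rw [add_dotProduct, smul_dotProduct, hz', smul_zero, add_zero]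
      exact hx.2 y hy
    have := (vectorSpan ℝ (minFace P w)).smul_mem ε⁻¹ (vsub_mem_vectorSpan ℝ hmem hx)
    rwa [vsub_eq_sub, add_sub_cancel_left, inv_smul_smul₀ hε] at this

theorem minFace_coordNormal {c : U → ℝ} (hc : ∀ u, 0 < c u) (a : U × I) :
    minFace (simplexProduct c) (fun b => ((coordNormal a b : ℤ) : ℝ)) =
      {x ∈ simplexProduct c | x a = 0} := by
  ext x
  simp only [minFace, dotProduct_coordNormal, Set.mem_ofPred_eq]
  refine and_congr_right fun hx => ⟨fun h => le_antisymm ?_ (hx.1 a), fun h y hy => ?_⟩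
  · exact h 0 ⟨fun _ => le_rfl, fun u => by simpa using (hc u).le⟩
  · rw [h]; exact hy.1 a

theorem minFace_blockNormal [Nonempty I] {c : U → ℝ} (hc : ∀ u, 0 < c u) (u : U) :
    minFace (simplexProduct c) (fun b : U × I => ((blockNormal u b : ℤ) : ℝ)) =
      {x ∈ simplexProduct c | ∑ i, x (u, i) = c u} := by
  ext x
  simp only [minFace, dotProduct_blockNormal, Set.mem_ofPred_eq, neg_le_neg_iff]
  refine and_congr_right fun hx => ⟨fun h => le_antisymm (hx.2 u) ?_, fun h y hy => ?_⟩
  · have hcard : (0 : ℝ) < Fintype.card I := by exact_mod_cast Fintype.card_pos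
    -- The test point has maximal sum in every block.
    have := h (fun a => c a.1 / Fintype.card I)
      ⟨fun a => (div_pos (hc _) hcard).le, fun v => ?_⟩
    · simpa [mul_div_cancel₀ _ hcard.ne'] using this
    · simp [mul_div_cancel₀ _ hcard.ne']
  · rw [h]; exact hy.2 u

-- At the chosen point `x a = 0` is the only tight inequality, so it can be moved a little in every
-- direction within the hyperplane.
open Topology in
theorem coordNormal_mem_facetNormals [Nonempty I] {c : U → ℝ} (hc : ∀ u, 0 < c u) (a : U × I) :
    coordNormal a ∈ facetNormals (simplexProduct c) := by
  have hcard : (0 : ℝ) < Fintype.card I := by exact_mod_cast Fintype.card_pos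
  let x : U × I → ℝ := fun b => if b = a then 0 else c b.1 / (2 * Fintype.card I)
  have hpos : ∀ b : U × I, 0 < c b.1 / (2 * Fintype.card I) := fun b => div_pos (hc _) (by positivity)
  have hsum : ∀ u, ∑ i, x (u, i) < c u := by
    intro u
    calc ∑ i, x (u, i) ≤ ∑ _i : I, c u / (2 * Fintype.card I) := by
          refine Finset.sum_le_sum fun i _ => ?_
          simp only [x]
          split_ifs
          · exact (hpos (u, i)).le
          · exact le_rfl
      _ = c u / 2 := by
          rw [Finset.sum_const, Finset.card_univ, nsmul_eq_mul]; field_simp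
      _ < c u := by linarith [hc u]
  have hx : x ∈ minFace (simplexProduct c) (fun b => ((coordNormal a b : ℤ) : ℝ)) := by
    rw [minFace_coordNormal hc]
    refine ⟨⟨fun b => ?_, fun u => (hsum u).le⟩, if_pos rfl⟩
    simp only [x]
    split_ifs
    · exact le_rfl
    · exact (hpos b).le
  have hw : (fun b => ((coordNormal a b : ℤ) : ℝ)) ≠ 0 := by
    intro h
    have := congrFun h a
    simp [coordNormal] at this
  refine ⟨gcd_univ_eq_one _ a (by simp [coordNormal]), ⟨x, hx⟩,
    finrank_vectorSpan_minFace _ _ hw x hx fun z hz => ?_⟩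
  rw [dotProduct_coordNormal] at hz
  have h1 : ∀ᶠ ε in 𝓝[≠] (0 : ℝ), ∀ b, b ≠ a → 0 < x b + ε * z b := by
    refine nhdsWithin_le_nhds (Filter.eventually_all.2 fun b => ?_)
    by_cases hb : b = a
    · simp [hb]
    · have hcont : Continuous fun ε : ℝ => x b + ε * z b := by fun_prop
      filter_upwards [hcont.continuousAt.eventually (lt_mem_nhds (a := 0) (by
        simpa [x, hb] using hpos b))] with ε hε _ using hε
  have h2 : ∀ᶠ ε in 𝓝[≠] (0 : ℝ), ∀ u, ∑ i, (x (u, i) + ε * z (u, i)) < c u := by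
    refine nhdsWithin_le_nhds (Filter.eventually_all.2 fun u => ?_)
    have hcont : Continuous fun ε : ℝ => ∑ i, (x (u, i) + ε * z (u, i)) := by fun_prop
    exact hcont.continuousAt.eventually (gt_mem_nhds (by simpa using hsum u))
  obtain ⟨ε, ⟨hε1, hε2⟩, hε⟩ := ((h1.and h2).and self_mem_nhdsWithin).exists
  refine ⟨ε, hε, fun b => ?_, fun u => (hε2 u).le⟩
  by_cases hb : b = a
  · simp [hb, hz, x]
  · exact (hε1 b hb).le

open Topology in
theorem blockNormal_mem_facetNormals [Nonempty I] {c : U → ℝ} (hc : ∀ u, 0 < c u) (u : U) :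
    blockNormal u ∈ facetNormals (simplexProduct c : Set (U × I → ℝ)) := by
  have hcard : (0 : ℝ) < Fintype.card I := by exact_mod_cast Fintype.card_pos
  -- The factor 1/2 makes the sum inequality strict in every block other than `u`.
  let r : U → ℝ := fun v => if v = u then 1 else 1 / 2
  let x : U × I → ℝ := fun b => r b.1 * c b.1 / Fintype.card I
  have hr : ∀ v, 0 < r v := fun v => by simp only [r]; split_ifs <;> norm_num
  have hpos : ∀ b, 0 < x b := fun b => div_pos (mul_pos (hr _) (hc _)) hcard
  have hsum : ∀ v, ∑ i, x (v, i) = r v * c v := by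
    intro v
    simp [x, mul_div_cancel₀ _ hcard.ne']
  have hsum' : ∀ v, v ≠ u → ∑ i, x (v, i) < c v := by
    intro v hv
    rw [hsum]
    simp only [r, if_neg hv]
    linarith [hc v]
  have hsumu : ∑ i, x (u, i) = c u := by rw [hsum]; simp [r]
  have hx : x ∈ minFace (simplexProduct c) (fun b : U × I => ((blockNormal u b : ℤ) : ℝ)) := by
    rw [minFace_blockNormal hc]
    refine ⟨⟨fun b => (hpos b).le, fun v => ?_⟩, hsumu⟩
    by_cases hv : v = u
    · rw [hv, hsumu]
    · exact (hsum' v hv).le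
  obtain ⟨i₀⟩ := ‹Nonempty I›
  have hw : (fun b : U × I => ((blockNormal u b : ℤ) : ℝ)) ≠ 0 := by
    intro h
    have := congrFun h (u, i₀)
    simp [blockNormal] at this
  refine ⟨gcd_univ_eq_one _ (u, i₀) (by simp [blockNormal]), ⟨x, hx⟩,
    finrank_vectorSpan_minFace _ _ hw x hx fun z hz => ?_⟩
  rw [dotProduct_blockNormal, neg_eq_zero] at hz
  have h1 : ∀ᶠ ε in 𝓝[≠] (0 : ℝ), ∀ b, 0 < x b + ε * z b := by
    refine nhdsWithin_le_nhds (Filter.eventually_all.2 fun b => ?_)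
    have hcont : Continuous fun ε : ℝ => x b + ε * z b := by fun_prop
    exact hcont.continuousAt.eventually (lt_mem_nhds (by simpa using hpos b))
  have h2 : ∀ᶠ ε in 𝓝[≠] (0 : ℝ), ∀ v, v ≠ u → ∑ i, (x (v, i) + ε * z (v, i)) < c v := by
    refine nhdsWithin_le_nhds (Filter.eventually_all.2 fun v => ?_)
    by_cases hv : v = u
    · simp [hv]
    · have hcont : Continuous fun ε : ℝ => ∑ i, (x (v, i) + ε * z (v, i)) := by fun_prop
      filter_upwards [hcont.continuousAt.eventually (gt_mem_nhds (b := ∑ i, (x (v, i) + 0 * z (v, i)))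
        (a := c v) (by simpa using hsum' v hv))] with ε hε _ using hε
  obtain ⟨ε, ⟨hε1, hε2⟩, hε⟩ := ((h1.and h2).and self_mem_nhdsWithin).exists
  refine ⟨ε, hε, fun b => (hε1 b).le, fun v => ?_⟩
  by_cases hv : v = u
  · subst hv
    simp [Finset.sum_add_distrib, ← Finset.mul_sum, hz, hsumu]
  · exact (hε2 v hv).le

/-- A linear functional that is constant on a facet is proportional to its normal. -/
theorem mul_eq_mul_of_finrank_vectorSpan {σ : Type*} [Fintype σ] [DecidableEq σ]
    (P : Set (σ → ℝ)) (w v : σ → ℝ) (hw : w ≠ 0)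
    (hdim : Module.finrank ℝ (vectorSpan ℝ (minFace P w)) + 1 = Fintype.card σ) (m : ℝ)
    (h : ∀ x ∈ minFace P w, x ⬝ᵥ v = m) (a b : σ) : v a * w b = v b * w a := by
  have h1 : vectorSpan ℝ (minFace P w) ≤ LinearMap.ker (dotProductBilin ℝ ℝ w) := by
    rcases (minFace P w).eq_empty_or_nonempty with h0 | ⟨x, hx⟩
    · simp [h0]
    · exact vectorSpan_le_ker_dotProduct _ _ (x ⬝ᵥ w)
        fun y hy => le_antisymm (hy.2 x hx.1) (hx.2 y hy.1)
  have h2 := Submodule.eq_of_le_of_finrank_eq h1 (by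
    have := finrank_ker_dotProduct hw
    omega)
  have h3 := vectorSpan_le_ker_dotProduct _ v m h
  rw [h2] at h3
  have h4 : (w b • Pi.single a 1 - w a • Pi.single b 1 : σ → ℝ) ∈
      LinearMap.ker (dotProductBilin ℝ ℝ w) := by
    change w ⬝ᵥ _ = 0
    rw [dotProduct_sub, dotProduct_smul, dotProduct_smul, dotProduct_single_one,
      dotProduct_single_one, smul_eq_mul, smul_eq_mul, mul_comm, sub_self]
  have h5 : v ⬝ᵥ (w b • Pi.single a 1 - w a • Pi.single b 1 : σ → ℝ) = 0 := h3 h4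
  rw [dotProduct_sub, dotProduct_smul, dotProduct_smul, dotProduct_single_one,
    dotProduct_single_one, smul_eq_mul, smul_eq_mul] at h5
  linarith

theorem sum_update_block (x : U × I → ℝ) (a : U × I) (r : ℝ) (u : U) :
    ∑ i, Function.update x a r (u, i) = ∑ i, x (u, i) + if u = a.1 then r - x a else 0 := by
  obtain ⟨v, j⟩ := a
  split_ifs with h
  · have h : u = v := h
    subst h
    have : ∀ i, Function.update x (u, j) r (u, i) =
        Function.update (fun i => x (u, i)) j r i := by
      intro i
      simp [Function.update_apply]
    simp only [this, Finset.sum_update_of_mem (Finset.mem_univ j)]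
    rw [← Finset.add_sum_erase Finset.univ (fun i => x (u, i)) (Finset.mem_univ j),
      Finset.sdiff_singleton_eq_erase]
    ring
  · rw [add_zero]
    refine Finset.sum_congr rfl fun i _ => Function.update_of_ne ?_ _ _
    intro h'
    exact h (congrArg Prod.fst h')

/-- The sign of a nonzero entry `w a` identifies the facet. If it is negative, minimality pushes the
sum of the block of `a` to its maximum; if positive, it pushes `x a` to zero. Either functional is
then constant on the facet, hence proportional to `w`, and primitivity fixes the factor. -/
theorem facetNormals_simplexProduct [Nonempty I] {c : U → ℝ} (hc : ∀ u, 0 < c u) :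
    facetNormals (simplexProduct c : Set (U × I → ℝ)) =
      Set.range coordNormal ∪ Set.range blockNormal := by
  refine Set.Subset.antisymm ?_ ?_
  · rintro w ⟨hgcd, hne, hdim⟩
    have hw : w ≠ 0 := by
      rintro rfl
      have : Finset.univ.gcd (0 : U × I → ℤ) = 0 := Finset.gcd_eq_zero_iff.2 fun _ _ => rfl
      rw [this] at hgcd
      exact zero_ne_one hgcd
    have hw' : (fun a => (w a : ℝ)) ≠ 0 := by
      intro h
      apply hw
      ext a
      simpa using congrFun h a
    obtain ⟨a, ha⟩ := Function.ne_iff.1 hw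
    have hdvd : ∀ v : U × I → ℤ, v a ≠ 0 → IsUnit (v a) → (∀ b, v a * w b = v b * w a) →
        IsUnit (w a) := by
      intro v _ hu hv
      refine isUnit_of_dvd_one (hgcd ▸ Finset.dvd_gcd fun b _ => ?_)
      exact hu.dvd_mul_left.1 ⟨v b, by rw [hv b, mul_comm]⟩
    rcases lt_or_gt_of_ne ha with hneg | hpos
    · right
      have key := mul_eq_mul_of_finrank_vectorSpan _ _
        (fun b : U × I => ((blockNormal a.1 b : ℤ) : ℝ)) hw' hdim (- c a.1) (fun x hx => ?_)
      · have key' : ∀ b, blockNormal a.1 a * w b = blockNormal a.1 b * w a :=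
          fun b => by exact_mod_cast key a b
        have hu := hdvd (blockNormal a.1) (by simp [blockNormal]) (by simp [blockNormal]) key'
        have hwa : w a = -1 := by
          rcases Int.isUnit_iff.1 hu with h | h
          · rw [h] at hneg; norm_num at hneg
          · exact h
        refine ⟨a.1, ?_⟩
        ext b
        have := key' b
        rw [hwa] at this
        simp only [blockNormal, if_true] at this ⊢
        linarith
      · rw [dotProduct_blockNormal]
        congr 1
        refine le_antisymm (hx.1.2 _) (le_of_not_gt fun hlt => ?_)
        -- Raising `x a` until the block is full would lower the inner product with `w`.
        have hmem : Function.update x a (x a + (c a.1 - ∑ i, x (a.1, i))) ∈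
            simplexProduct c := by
          refine ⟨fun b => ?_, fun u => ?_⟩
          · rw [Function.update_apply]
            split_ifs
            · have := hx.1.1 a; linarith
            · exact hx.1.1 b
          · rw [sum_update_block]
            split_ifs with h
            · rw [h]; linarith
            · rw [add_zero]; exact hx.1.2 u
        have h1 := hx.2 _ hmem
        have h2 : Function.update x a (x a + (c a.1 - ∑ i, x (a.1, i))) =
            x + Pi.single a (c a.1 - ∑ i, x (a.1, i)) := by
          ext b
          by_cases hb : b = a
          · subst hb; simp
          · simp [hb]
        rw [h2, add_dotProduct, single_dotProduct] at h1
        have h3 : (w a : ℝ) < 0 := by exact_mod_cast hneg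
        nlinarith
    · left
      have key := mul_eq_mul_of_finrank_vectorSpan _ _
        (fun b : U × I => ((coordNormal a b : ℤ) : ℝ)) hw' hdim 0 (fun x hx => ?_)
      · have key' : ∀ b, coordNormal a a * w b = coordNormal a b * w a :=
          fun b => by exact_mod_cast key a b
        have hu := hdvd (coordNormal a) (by simp [coordNormal]) (by simp [coordNormal]) key'
        have hwa : w a = 1 := by
          rcases Int.isUnit_iff.1 hu with h | h
          · exact h
          · rw [h] at hpos; norm_num at hpos
        refine ⟨a, ?_⟩
        ext b
        have := key' b
        rw [hwa] at this
        simp only [coordNormal, Pi.single_eq_same] at this ⊢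
        linarith
      · rw [dotProduct_coordNormal]
        refine le_antisymm (le_of_not_gt fun hlt => ?_) (hx.1.1 a)
        have hmem : Function.update x a 0 ∈ simplexProduct c := by
          refine ⟨fun b => ?_, fun u => ?_⟩
          · rw [Function.update_apply]
            split_ifs
            · exact le_rfl
            · exact hx.1.1 b
          · rw [sum_update_block]
            have := hx.1.2 u
            split_ifs <;> linarith
        have h1 := hx.2 _ hmem
        have h2 : Function.update x a 0 = x - Pi.single a (x a) := by
          ext b
          by_cases hb : b = a
          · subst hb; simp
          · simp [hb]
        rw [h2, sub_dotProduct, single_dotProduct] at h1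
        have h3 : (0 : ℝ) < w a := by exact_mod_cast hpos
        nlinarith
  · rintro _ (⟨a, rfl⟩ | ⟨u, rfl⟩)
    · exact coordNormal_mem_facetNormals hc a
    · exact blockNormal_mem_facetNormals hc u

theorem coordNormal_injective : Function.Injective (coordNormal : U × I → U × I → ℤ) := by
  intro a b h
  by_contra hab
  have := congrFun h a
  simp [coordNormal, hab] at this

theorem blockNormal_injective [Nonempty I] :
    Function.Injective (blockNormal : U → U × I → ℤ) := by
  intro u v h
  obtain ⟨i⟩ := ‹Nonempty I›
  by_contra huv
  have := congrFun h (u, i)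
  simp [blockNormal, huv] at this

theorem coordNormal_ne_blockNormal (a : U × I) (u : U) : coordNormal a ≠ blockNormal u := by
  intro h
  have := congrFun h a
  simp only [coordNormal, Pi.single_eq_same, blockNormal] at this
  split_ifs at this
  norm_num at this

theorem ncard_subsets_facetNormals [Nonempty I] {c : U → ℝ} (hc : ∀ u, 0 < c u) :
    {S : Finset (U × I → ℤ) | (S : Set (U × I → ℤ)) ⊆
      facetNormals (simplexProduct c : Set (U × I → ℝ))}.ncard =
      2 ^ ((Fintype.card I + 1) * Fintype.card U) := by
  classical
  have h1 : facetNormals (simplexProduct c : Set (U × I → ℝ)) =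
      ((Finset.univ.image coordNormal ∪ Finset.univ.image blockNormal : Finset (U × I → ℤ)) :
        Set (U × I → ℤ)) := by
    rw [facetNormals_simplexProduct hc]
    simp
  have h2 : {S : Finset (U × I → ℤ) | (S : Set (U × I → ℤ)) ⊆
      facetNormals (simplexProduct c : Set (U × I → ℝ))} =
      ((Finset.univ.image coordNormal ∪ Finset.univ.image blockNormal :
        Finset (U × I → ℤ)).powerset : Set (Finset (U × I → ℤ))) := by
    ext S
    rw [Set.mem_ofPred_eq, h1, Finset.coe_subset, Finset.mem_coe, Finset.mem_powerset]
  rw [h2, Set.ncard_coe_finset, Finset.card_powerset, Finset.card_union_of_disjoint,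
    Finset.card_image_of_injective _ coordNormal_injective,
    Finset.card_image_of_injective _ blockNormal_injective, Finset.card_univ, Finset.card_univ,
    Fintype.card_prod]
  · ring_nf
  · rw [Finset.disjoint_left]
    intro w hw hw'
    obtain ⟨a, -, rfl⟩ := Finset.mem_image.1 hw
    obtain ⟨u, -, hu⟩ := Finset.mem_image.1 hw'
    exact coordNormal_ne_blockNormal a u hu.symm

/-- At `(u, i)` only the normals `coordNormal (u, i)` and `blockNormal u` are nonzero, so the entry
is a difference of two indicators, the second of which is the same throughout the block. -/
theorem faceNormals_simplexProduct_block [Nonempty I] {c : U → ℝ} (hc : ∀ u, 0 < c u)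
    {w : U × I → ℤ} (hw : w ∈ faceNormals (simplexProduct c : Set (U × I → ℝ))) (u : U) :
    (∀ i, w (u, i) = 0 ∨ w (u, i) = 1) ∨ ∀ i, w (u, i) = -1 ∨ w (u, i) = 0 := by
  obtain ⟨-, S, hS, rfl⟩ := hw
  rw [facetNormals_simplexProduct hc] at hS
  have key : ∀ i, (∑ v ∈ S, v) (u, i) =
      (if coordNormal (u, i) ∈ S then 1 else 0) - if blockNormal u ∈ S then 1 else 0 := by
    intro i
    rw [Finset.sum_apply, ← Finset.sum_ite_eq S (coordNormal (u, i)) fun _ => (1 : ℤ),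
      ← Finset.sum_ite_eq S (blockNormal u) fun _ => (1 : ℤ), ← Finset.sum_sub_distrib]
    refine Finset.sum_congr rfl fun v hv => ?_
    rcases hS hv with ⟨a, rfl⟩ | ⟨u', rfl⟩
    · rw [if_neg (coordNormal_ne_blockNormal a u).symm, sub_zero]
      simp only [coordNormal_injective.eq_iff]
      simp only [coordNormal, Pi.single_apply]
    · rw [if_neg (coordNormal_ne_blockNormal (u, i) u'), zero_sub]
      simp only [blockNormal_injective.eq_iff, blockNormal]
      split_ifs <;> simp
  simp only [key]
  by_cases h : blockNormal u ∈ S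
  · right
    intro i
    split_ifs <;> simp
  · left
    intro i
    rw [if_neg h]
    split_ifs <;> simp

theorem faceNormals_simplexProduct_of_blocks [Nonempty I] {c : U → ℝ} (hc : ∀ u, 0 < c u)
    {B : Finset U} (hB : B.Nonempty) :
    (fun a => if a.1 ∈ B then -1 else 0) ∈
      faceNormals (simplexProduct c : Set (U × I → ℝ)) := by
  classical
  obtain ⟨i⟩ := ‹Nonempty I›
  refine ⟨fun h => ?_, B.image blockNormal, ?_, ?_⟩
  · obtain ⟨u, hu⟩ := hB
    have := congrFun h (u, i)
    simp [hu] at this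
  · rw [Finset.coe_image]
    rintro _ ⟨u, -, rfl⟩
    have : Nonempty I := ⟨i⟩
    exact blockNormal_mem_facetNormals hc u
  · have : Nonempty I := ⟨i⟩
    rw [Finset.sum_image blockNormal_injective.injOn]
    ext a
    simp [Finset.sum_apply, blockNormal]

end FacetNormals

end SphereEquations

namespace SphereEquations

/-! ### Multihomogenization, the δ-transform and initial forms -/

section Homogenization

set_option linter.unusedSectionVars false

open MvPolynomial

variable {U I : Type*} [Fintype U] [DecidableEq U] [Fintype I] [DecidableEq I]

/-- The monomial `x^α` homogenized to degree `D u` in each block of variables. -/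
noncomputable def homMonomial (D : U → ℕ) (h : U → ℂ) (x : U × I → ℂ) (α : U × I →₀ ℕ) : ℂ :=
  (∏ u, h u ^ (D u - ∑ i, α (u, i))) * ∏ a, x a ^ α a

/-- The value at `(h, x)` of the polynomial obtained from `f` by homogenizing with degree `D u`
in each block of variables. -/
noncomputable def homEval (D : U → ℕ) (h : U → ℂ) (x : U × I → ℂ) : MvPolynomial (U × I) ℂ →ₗ[ℂ] ℂ :=
  (basisMonomials (U × I) ℂ).constr ℂ (homMonomial D h x)

/-- The degree of `f` in each block `u` is at most `D u`. -/
def BlockDegreeLE (D : U → ℕ) (f : MvPolynomial (U × I) ℂ) : Prop :=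
  ∀ α ∈ f.support, ∀ u, ∑ i, α (u, i) ≤ D u

theorem homEval_monomial (D : U → ℕ) (h : U → ℂ) (x : U × I → ℂ) (α : U × I →₀ ℕ) (c : ℂ) :
    homEval D h x (monomial α c) = c * homMonomial D h x α := by
  have h1 : (monomial α c : MvPolynomial (U × I) ℂ) = c • basisMonomials (U × I) ℂ α := by
    rw [coe_basisMonomials, smul_monomial, smul_eq_mul, mul_one]
  rw [h1, map_smul, homEval, Module.Basis.constr_basis, smul_eq_mul]

theorem homEval_eq_sum (D : U → ℕ) (h : U → ℂ) (x : U × I → ℂ) (f : MvPolynomial (U × I) ℂ) :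
    homEval D h x f = ∑ α ∈ f.support, f.coeff α * homMonomial D h x α := by
  conv_lhs => rw [f.as_sum]
  simp only [map_sum, homEval_monomial]

/-- The exponents of `h` are truncated differences; the degree bounds make them genuine, so that
they add. -/
theorem homEval_mul {D D' : U → ℕ} {f g : MvPolynomial (U × I) ℂ} (hf : BlockDegreeLE D f)
    (hg : BlockDegreeLE D' g) (h : U → ℂ) (x : U × I → ℂ) :
    homEval (D + D') h x (f * g) = homEval D h x f * homEval D' h x g := by
  rw [homEval_eq_sum D, homEval_eq_sum D', Finset.sum_mul_sum]
  conv_lhs => rw [f.as_sum, g.as_sum]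
  rw [Finset.sum_mul_sum, map_sum]
  refine Finset.sum_congr rfl fun α hα => ?_
  rw [map_sum]
  refine Finset.sum_congr rfl fun β hβ => ?_
  rw [monomial_mul, homEval_monomial]
  have h1 : homMonomial (D + D') h x (α + β) = homMonomial D h x α * homMonomial D' h x β := by
    simp only [homMonomial, Finsupp.add_apply, pow_add, Finset.prod_mul_distrib,
      Finset.sum_add_distrib, Pi.add_apply]
    have h2 : ∀ u, h u ^ (D u + D' u - (∑ i, α (u, i) + ∑ i, β (u, i))) =
        h u ^ (D u - ∑ i, α (u, i)) * h u ^ (D' u - ∑ i, β (u, i)) := by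
      intro u
      rw [← pow_add]
      have := hf α hα u
      have := hg β hβ u
      congr 1
      omega
    simp only [h2, Finset.prod_mul_distrib]
    ring
  rw [h1]
  ring

theorem BlockDegreeLE.add {D : U → ℕ} {f g : MvPolynomial (U × I) ℂ} (hf : BlockDegreeLE D f)
    (hg : BlockDegreeLE D g) : BlockDegreeLE D (f + g) := by
  intro α hα
  rcases Finset.mem_union.1 (support_add hα) with h | h
  · exact hf α h
  · exact hg α h

theorem BlockDegreeLE.neg {D : U → ℕ} {f : MvPolynomial (U × I) ℂ} (hf : BlockDegreeLE D f) :
    BlockDegreeLE D (-f) := by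
  intro α hα
  exact hf α (by rwa [support_neg] at hα)

theorem BlockDegreeLE.sub {D : U → ℕ} {f g : MvPolynomial (U × I) ℂ} (hf : BlockDegreeLE D f)
    (hg : BlockDegreeLE D g) : BlockDegreeLE D (f - g) := by
  rw [sub_eq_add_neg]; exact hf.add hg.neg

theorem BlockDegreeLE.mul {D D' : U → ℕ} {f g : MvPolynomial (U × I) ℂ}
    (hf : BlockDegreeLE D f) (hg : BlockDegreeLE D' g) : BlockDegreeLE (D + D') (f * g) := by
  intro γ hγ u
  obtain ⟨α, hα, β, hβ, rfl⟩ := Finset.mem_add.1 (support_mul _ _ hγ)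
  simp only [Finsupp.add_apply, Finset.sum_add_distrib, Pi.add_apply]
  exact add_le_add (hf α hα u) (hg β hβ u)

theorem BlockDegreeLE.sum {D : U → ℕ} {ι : Type*} (s : Finset ι)
    {f : ι → MvPolynomial (U × I) ℂ} (hf : ∀ i ∈ s, BlockDegreeLE D (f i)) :
    BlockDegreeLE D (∑ i ∈ s, f i) := by
  classical
  induction s using Finset.induction_on with
  | empty => simp [BlockDegreeLE]
  | insert i s hi ih =>
    rw [Finset.sum_insert hi]
    exact (hf i (Finset.mem_insert_self _ _)).add
      (ih fun j hj => hf j (Finset.mem_insert_of_mem hj))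

theorem blockDegreeLE_C (D : U → ℕ) (c : ℂ) :
    BlockDegreeLE D (C c : MvPolynomial (U × I) ℂ) := by
  intro α hα u
  have : α = 0 := by
    by_contra h
    rw [mem_support_iff, coeff_C, if_neg (Ne.symm h)] at hα
    exact hα rfl
  simp [this]

theorem blockDegreeLE_X (a : U × I) :
    BlockDegreeLE (Pi.single a.1 1) (X a : MvPolynomial (U × I) ℂ) := by
  intro α hα u
  rw [support_X, Finset.mem_singleton] at hα
  subst hα
  obtain ⟨v, j⟩ := a
  by_cases huv : u = v
  · subst huv
    simp [Finsupp.single_apply]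
  · simp [Ne.symm huv]

theorem blockDegreeLE_blockDegree (f : MvPolynomial (U × I) ℂ) :
    BlockDegreeLE (fun u => blockDegree u f) f :=
  fun _ hα _ => Finset.le_sup (f := fun α : U × I →₀ ℕ => ∑ i, α (_, i)) hα

theorem homEval_C (h : U → ℂ) (x : U × I → ℂ) (c : ℂ) (D : U → ℕ) :
    homEval D h x (C c) = c * ∏ u, h u ^ D u := by
  rw [← monomial_zero', homEval_monomial]
  simp [homMonomial]

theorem homEval_X (h : U → ℂ) (x : U × I → ℂ) (a : U × I) :
    homEval (Pi.single a.1 1) h x (X a) = x a := by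
  rw [X, homEval_monomial, one_mul, homMonomial]
  have h1 : ∀ u, h u ^ ((Pi.single a.1 1 : U → ℕ) u -
      ∑ i, (Finsupp.single a 1 : U × I →₀ ℕ) (u, i)) = 1 := by
    intro u
    obtain ⟨v, j⟩ := a
    by_cases huv : u = v
    · subst huv
      simp [Finsupp.single_apply]
    · simp [huv]
  simp only [h1, Finset.prod_const_one, one_mul]
  rw [Finset.prod_eq_single a]
  · simp
  · intro b _ hb
    simp [hb.symm]
  · simp

theorem homEval_scale {D : U → ℕ} {f : MvPolynomial (U × I) ℂ} (hf : BlockDegreeLE D f)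
    (c h : U → ℂ) (x : U × I → ℂ) :
    homEval D (fun u => c u * h u) (fun a => c a.1 * x a) f =
      (∏ u, c u ^ D u) * homEval D h x f := by
  rw [homEval_eq_sum, homEval_eq_sum, Finset.mul_sum]
  refine Finset.sum_congr rfl fun α hα => ?_
  simp only [homMonomial, mul_pow, Finset.prod_mul_distrib]
  have h1 : (∏ a : U × I, c a.1 ^ α a) = ∏ u, c u ^ ∑ i, α (u, i) := by
    rw [Fintype.prod_prod_type]
    exact Finset.prod_congr rfl fun u _ => Finset.prod_pow_eq_pow_sum Finset.univ (fun i => α (u, i)) (c u)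
  have h2 : (∏ u, c u ^ D u) = (∏ u, c u ^ (D u - ∑ i, α (u, i))) *
      ∏ u, c u ^ ∑ i, α (u, i) := by
    rw [← Finset.prod_mul_distrib]
    refine Finset.prod_congr rfl fun u _ => ?_
    rw [← pow_add, Nat.sub_add_cancel (hf α hα u)]
  rw [h1, h2]
  ring

theorem exists_mem_support_of_homEval_ne_zero {D : U → ℕ} {h : U → ℂ} {x : U × I → ℂ}
    {f : MvPolynomial (U × I) ℂ} (hf : homEval D h x f ≠ 0) :
    ∃ α ∈ f.support, ∀ u, h u = 0 → D u ≤ ∑ i, α (u, i) := by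
  rw [homEval_eq_sum] at hf
  obtain ⟨α, hα, hne⟩ := Finset.exists_ne_zero_of_sum_ne_zero hf
  refine ⟨α, hα, fun u hu => ?_⟩
  by_contra! hlt
  apply hne
  rw [homMonomial, Finset.prod_eq_zero (Finset.mem_univ u), zero_mul, mul_zero]
  rw [hu, zero_pow]
  omega

/-- The δ-transform is the multihomogenization in another affine chart: `t (u, L u)` is the
homogenizing coordinate and `x (u, L u)` is set to 1. -/
theorem eval_deltaTransform (L : U → I) (f : MvPolynomial (U × I) ℂ) (t : U × I → ℂ) :
    eval t (deltaTransform L f) =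
      homEval (fun u => blockDegree u f) (fun u => t (u, L u))
        (fun a => if a.2 = L a.1 then 1 else t a) f := by
  rw [homEval_eq_sum, deltaTransform, map_sum]
  refine Finset.sum_congr rfl fun α _ => ?_
  rw [eval_monomial, Finsupp.prod_fintype _ _ (by simp), homMonomial, Fintype.prod_prod_type,
    Fintype.prod_prod_type, ← Finset.prod_mul_distrib]
  congr 1
  refine Finset.prod_congr rfl fun u _ => ?_
  have h1 : ∀ g : I → ℂ, ∏ i, g i = g (L u) * ∏ i ∈ Finset.univ.erase (L u), g i :=
    fun g => (Finset.mul_prod_erase _ _ (Finset.mem_univ _)).symm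
  rw [h1, h1 fun i => (if (u, i).2 = L (u, i).1 then (1 : ℂ) else t (u, i)) ^ α (u, i)]
  simp only [Finsupp.equivFunOnFinite_symm_apply_apply, if_true, one_pow, one_mul]
  congr 1
  refine Finset.prod_congr rfl fun i hi => ?_
  have hi' := Finset.ne_of_mem_erase hi
  simp only [if_neg hi']

/-- The support of the part of `f` that has the maximal degree in the blocks of `B` and does not
involve the variables of `Z`. -/
noncomputable def leadSupport (B : Finset U) (Z : Finset (U × I)) (f : MvPolynomial (U × I) ℂ) :
    Finset (U × I →₀ ℕ) :=
  f.support.filter fun α => (∀ u ∈ B, ∑ i, α (u, i) = blockDegree u f) ∧ ∀ a ∈ Z, α a = 0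

theorem homEval_eq_sum_leadSupport (B : Finset U) (Z : Finset (U × I))
    (f : MvPolynomial (U × I) ℂ) (x : U × I → ℂ) :
    homEval (fun u => blockDegree u f) (fun u => if u ∈ B then 0 else 1)
        (fun a => if a ∈ Z then 0 else x a) f =
      ∑ α ∈ leadSupport B Z f, f.coeff α * ∏ a, x a ^ α a := by
  rw [homEval_eq_sum, leadSupport, Finset.sum_filter]
  refine Finset.sum_congr rfl fun α hα => ?_
  split_ifs with h
  · congr 1
    rw [homMonomial, Finset.prod_eq_one, one_mul]
    · refine Finset.prod_congr rfl fun a _ => ?_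
      split_ifs with ha
      · rw [h.2 a ha, pow_zero, pow_zero]
      · rfl
    · intro u _
      split_ifs with hu
      · rw [h.1 u hu, Nat.sub_self, pow_zero]
      · exact one_pow _
  · rw [homMonomial]
    by_cases hB : ∀ u ∈ B, ∑ i, α (u, i) = blockDegree u f
    · have hZ : ¬ ∀ a ∈ Z, α a = 0 := fun hZ => h ⟨hB, hZ⟩
      push Not at hZ
      obtain ⟨a, ha, hαa⟩ := hZ
      rw [Finset.prod_eq_zero (f := fun a => (if a ∈ Z then 0 else x a) ^ α a)
        (Finset.mem_univ a), mul_zero, mul_zero]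
      rw [if_pos ha, zero_pow hαa]
    · push Not at hB
      obtain ⟨u, hu, hne⟩ := hB
      rw [Finset.prod_eq_zero (Finset.mem_univ u), zero_mul, mul_zero]
      rw [if_pos hu, zero_pow]
      have := blockDegreeLE_blockDegree f α hα u
      simp only at this
      omega

theorem sum_mul_weight (B : Finset U) (Z : Finset (U × I)) (w : U × I → ℤ)
    (hw : ∀ a, w a = (if a.1 ∈ B then -1 else 0) + if a ∈ Z then 1 else 0)
    (α : U × I →₀ ℕ) :
    ∑ a, (α a : ℤ) * w a = ((∑ a ∈ Z, α a : ℕ) : ℤ) - ((∑ u ∈ B, ∑ i, α (u, i) : ℕ) : ℤ) := by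
  simp only [hw, mul_add, Finset.sum_add_distrib, mul_ite, mul_neg, mul_one, mul_zero,
    Fintype.sum_prod_type (f := fun a : U × I => if a.1 ∈ B then -(α a : ℤ) else 0)]
  rw [Finset.sum_ite_mem, Finset.univ_inter]
  have : ∀ u, (∑ i, if u ∈ B then -(α (u, i) : ℤ) else 0) =
      if u ∈ B then -∑ i, (α (u, i) : ℤ) else 0 := by
    intro u
    split_ifs <;> simp
  simp only [this]
  rw [Finset.sum_ite_mem, Finset.univ_inter]
  push_cast
  rw [Finset.sum_neg_distrib]
  ring

/-- The weight of an exponent is its degree in `Z` minus its degree in the blocks of `B`. It is at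
least minus the sum of the block degrees over `B`, with equality exactly on `leadSupport`; once this
is nonempty, it is the set of minimizers. -/
theorem eval_initialForm_of_nonempty (B : Finset U) (Z : Finset (U × I)) (w : U × I → ℤ)
    (hw : ∀ a, w a = (if a.1 ∈ B then -1 else 0) + if a ∈ Z then 1 else 0)
    (f : MvPolynomial (U × I) ℂ) (hne : (leadSupport B Z f).Nonempty) (x : U × I → ℂ) :
    eval x (initialForm w f) =
      homEval (fun u => blockDegree u f) (fun u => if u ∈ B then 0 else 1)
        (fun a => if a ∈ Z then 0 else x a) f := by
  rw [homEval_eq_sum_leadSupport, initialForm, map_sum]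
  have hle : ∀ α ∈ f.support, ∑ u ∈ B, ∑ i, α (u, i) ≤ ∑ u ∈ B, blockDegree u f :=
    fun α hα => Finset.sum_le_sum fun u _ => blockDegreeLE_blockDegree f α hα u
  obtain ⟨β, hβ⟩ := hne
  obtain ⟨hβs, hβB, hβZ⟩ := Finset.mem_filter.1 hβ
  have hβw : ∑ a, (β a : ℤ) * w a = -((∑ u ∈ B, blockDegree u f : ℕ) : ℤ) := by
    rw [sum_mul_weight B Z w hw, Finset.sum_eq_zero hβZ, Finset.sum_congr rfl hβB]
    simp
  refine Finset.sum_congr ?_ fun α _ => ?_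
  · ext α
    simp only [leadSupport, Finset.mem_filter]
    refine and_congr_right fun hα => ⟨fun h => ?_, fun h γ hγ => ?_⟩
    · have h1 := h β hβs
      rw [hβw, sum_mul_weight B Z w hw] at h1
      have h2 := hle α hα
      have h3 : ∑ a ∈ Z, α a = 0 := by omega
      have h4 : ∑ u ∈ B, ∑ i, α (u, i) = ∑ u ∈ B, blockDegree u f := by omega
      refine ⟨(Finset.sum_eq_sum_iff_of_le fun u _ => ?_).1 h4, Finset.sum_eq_zero_iff.1 h3⟩
      exact blockDegreeLE_blockDegree f α hα u
    · have h1 := hle γ hγ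
      rw [sum_mul_weight B Z w hw, sum_mul_weight B Z w hw, Finset.sum_eq_zero h.2,
        Finset.sum_congr rfl h.1]
      omega
  · rw [eval_monomial, Finsupp.prod_fintype _ _ (by simp)]

/-- When `leadSupport` is empty the initial form may be something else, but then the homogenized
value is an empty sum. -/
theorem homEval_eq_zero_of_eval_initialForm (B : Finset U) (Z : Finset (U × I)) (w : U × I → ℤ)
    (hw : ∀ a, w a = (if a.1 ∈ B then -1 else 0) + if a ∈ Z then 1 else 0)
    (f : MvPolynomial (U × I) ℂ) (x : U × I → ℂ) (hx : eval x (initialForm w f) = 0) :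
    homEval (fun u => blockDegree u f) (fun u => if u ∈ B then 0 else 1)
      (fun a => if a ∈ Z then 0 else x a) f = 0 := by
  rcases (leadSupport B Z f).eq_empty_or_nonempty with h | h
  · rw [homEval_eq_sum_leadSupport, h, Finset.sum_empty]
  · rw [← eval_initialForm_of_nonempty B Z w hw f h, hx]

end Homogenization

end SphereEquations

namespace SphereEquations

/-! ### The multihomogenized sphere equations and their symmetries -/

section HomogeneousSystem

set_option linter.unusedSectionVars false

open MvPolynomial

variable {V : Type*} [Fintype V] [DecidableEq V] (G : SimpleGraph V) (K : Finset V) {d : ℕ}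

/-- The homogenizing coordinate of `v`, which is one if `v` is fixed. -/
def homCoord (h : FreeVertex K → ℂ) (v : V) : ℂ := if hv : v ∈ K then 1 else h ⟨v, hv⟩

/-- The value of the `k`-th coordinate of `v`. -/
def coordValue (p : {v : V // v ∈ K} → Fin d → ℂ) (x : Var K d → ℂ) (v : V) (k : Fin d) : ℂ :=
  if hv : v ∈ K then p ⟨v, hv⟩ k else x (⟨v, hv⟩, some k)

/-- The value of the magnitude of `v`. -/
noncomputable def magnitudeValue (p : {v : V // v ∈ K} → Fin d → ℂ) (x : Var K d → ℂ) (v : V) :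
    ℂ :=
  if hv : v ∈ K then ∑ k, p ⟨v, hv⟩ k ^ 2 else x (⟨v, hv⟩, none)

/-- The degree in the block of `v`. -/
def vertexDegree (v : V) : FreeVertex K → ℕ := if hv : v ∈ K then 0 else Pi.single ⟨v, hv⟩ 1

/-- The multihomogenized edge equation of the pair `u`, `v`. -/
noncomputable def homEdge (p : {v : V // v ∈ K} → Fin d → ℂ) (l : ℂ) (h : FreeVertex K → ℂ)
    (x : Var K d → ℂ) (u v : V) : ℂ :=
  magnitudeValue K p x u * homCoord K h v + magnitudeValue K p x v * homCoord K h u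
    - 2 * ∑ k, coordValue K p x u k * coordValue K p x v k
    - l ^ 2 * (homCoord K h u * homCoord K h v)

/-- The pair `(h, x)` solves the multihomogenized sphere equations. -/
def IsHomSolution (p : {v : V // v ∈ K} → Fin d → ℂ) (lam : FreeEdge G K → ℂ)
    (h : FreeVertex K → ℂ) (x : Var K d → ℂ) : Prop :=
  (∀ u, ∑ k : Fin d, x (u, some k) ^ 2 = x (u, none) * h u) ∧
    ∀ (e : FreeEdge G K) (u v : V), e.1 = s(u, v) → homEdge K p (lam e) h x u v = 0

variable (p : {v : V // v ∈ K} → Fin d → ℂ) (lam : FreeEdge G K → ℂ)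

theorem prod_pow_vertexDegree (h : FreeVertex K → ℂ) (v : V) :
    ∏ u, h u ^ vertexDegree K v u = homCoord K h v := by
  unfold vertexDegree homCoord
  split_ifs with hv
  · simp
  · rw [Finset.prod_eq_single ⟨v, hv⟩]
    · simp
    · intro u _ hu
      simp [hu]
    · simp

theorem blockDegreeLE_coord (v : V) (k : Fin d) :
    BlockDegreeLE (vertexDegree K v) (coord K p v k) := by
  unfold vertexDegree coord
  split_ifs with hv
  · exact blockDegreeLE_C 0 _
  · exact blockDegreeLE_X (U := FreeVertex K) (I := Option (Fin d)) (⟨v, hv⟩, some k)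

theorem blockDegreeLE_magnitude (v : V) :
    BlockDegreeLE (vertexDegree K v) (magnitude K p v) := by
  unfold vertexDegree magnitude
  split_ifs with hv
  · exact blockDegreeLE_C 0 _
  · exact blockDegreeLE_X (U := FreeVertex K) (I := Option (Fin d)) (⟨v, hv⟩, none)

theorem homEval_coord (h : FreeVertex K → ℂ) (x : Var K d → ℂ) (v : V) (k : Fin d) :
    homEval (vertexDegree K v) h x (coord K p v k) = coordValue K p x v k := by
  unfold vertexDegree coord coordValue
  split_ifs with hv
  · simp [homEval_C]
  · exact homEval_X h x (⟨v, hv⟩, some k)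

theorem homEval_magnitude (h : FreeVertex K → ℂ) (x : Var K d → ℂ) (v : V) :
    homEval (vertexDegree K v) h x (magnitude K p v) = magnitudeValue K p x v := by
  unfold vertexDegree magnitude magnitudeValue
  split_ifs with hv
  · rw [homEval_C]
    simp
  · exact homEval_X h x (⟨v, hv⟩, none)

/-- The constant factors allow `homEval_mul` to bring every summand to the common multidegree of the
two ends. -/
theorem edgePolynomial_mk (l : ℂ) (u v : V) :
    edgePolynomial K p l s(u, v) = magnitude K p u * C 1 + C 1 * magnitude K p v
      - C 2 * ∑ k, coord K p u k * coord K p v k - C (l ^ 2) := by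
  rw [C_1, mul_one, one_mul]
  rfl

theorem blockDegreeLE_edgePolynomial (l : ℂ) (u v : V) :
    BlockDegreeLE (vertexDegree K u + vertexDegree K v) (edgePolynomial K p l s(u, v)) := by
  rw [edgePolynomial_mk]
  refine ((((blockDegreeLE_magnitude K p u).mul (blockDegreeLE_C _ _)).add
    ((blockDegreeLE_C _ _).mul (blockDegreeLE_magnitude K p v))).sub ?_).sub (blockDegreeLE_C _ _)
  have := (blockDegreeLE_C (0 : FreeVertex K → ℕ) (2 : ℂ)).mul (BlockDegreeLE.sum Finset.univ
    fun k _ => (blockDegreeLE_coord K p u k).mul (blockDegreeLE_coord K p v k))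
  rwa [zero_add] at this

theorem homEval_edgePolynomial (l : ℂ) (h : FreeVertex K → ℂ) (x : Var K d → ℂ) (u v : V) :
    homEval (vertexDegree K u + vertexDegree K v) h x (edgePolynomial K p l s(u, v)) =
      homEdge K p l h x u v := by
  have hcc : ∀ k, BlockDegreeLE (vertexDegree K u + vertexDegree K v)
      (coord K p u k * coord K p v k) :=
    fun k => (blockDegreeLE_coord K p u k).mul (blockDegreeLE_coord K p v k)
  have h2 : homEval (vertexDegree K u + vertexDegree K v) h x
      (C 2 * ∑ k, coord K p u k * coord K p v k) =
      2 * ∑ k, coordValue K p x u k * coordValue K p x v k := by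
    have := homEval_mul (blockDegreeLE_C (0 : FreeVertex K → ℕ) (2 : ℂ))
      (BlockDegreeLE.sum Finset.univ fun k _ => hcc k) h x
    rw [zero_add] at this
    rw [this, homEval_C, map_sum]
    simp [homEval_mul (blockDegreeLE_coord K p u _) (blockDegreeLE_coord K p v _), homEval_coord]
  rw [edgePolynomial_mk, map_sub, map_sub, map_add, h2,
    homEval_mul (blockDegreeLE_magnitude K p u) (blockDegreeLE_C _ _),
    homEval_mul (blockDegreeLE_C _ _) (blockDegreeLE_magnitude K p v),
    homEval_C, homEval_C, homEval_C, homEval_magnitude, homEval_magnitude]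
  simp only [Pi.add_apply, pow_add, Finset.prod_mul_distrib, prod_pow_vertexDegree]
  unfold homEdge
  ring

theorem blockDegreeLE_magnitudeEquation (u : FreeVertex K) :
    BlockDegreeLE (Pi.single u 1 + Pi.single u 1)
      (∑ k : Fin d, X (u, some k) ^ 2 - X (u, none) : MvPolynomial (Var K d) ℂ) := by
  refine (BlockDegreeLE.sum _ fun k _ => ?_).sub ?_
  · rw [sq]
    exact (blockDegreeLE_X (u, some k)).mul (blockDegreeLE_X (u, some k))
  · rw [← mul_one (X _), ← C_1]
    exact (blockDegreeLE_X (u, none)).mul (blockDegreeLE_C _ _)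

theorem homEval_magnitudeEquation (h : FreeVertex K → ℂ) (x : Var K d → ℂ) (u : FreeVertex K) :
    homEval (Pi.single u 1 + Pi.single u 1) h x
      (∑ k : Fin d, X (u, some k) ^ 2 - X (u, none) : MvPolynomial (Var K d) ℂ) =
      ∑ k : Fin d, x (u, some k) ^ 2 - x (u, none) * h u := by
  have h1 : homEval (Pi.single u 1 + Pi.single u 1) h x
      (X (u, none) : MvPolynomial (Var K d) ℂ) = x (u, none) * h u := by
    rw [← mul_one (X _), ← C_1, homEval_mul (blockDegreeLE_X (u, none)) (blockDegreeLE_C _ _),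
      homEval_C, homEval_X h x (u, none), one_mul]
    congr 1
    rw [Finset.prod_eq_single u]
    · simp
    · intro v _ hv
      simp [hv]
    · simp
  rw [map_sub, h1, map_sum]
  congr 1
  refine Finset.sum_congr rfl fun k _ => ?_
  rw [sq, homEval_mul (blockDegreeLE_X (u, some k)) (blockDegreeLE_X (u, some k)),
    homEval_X h x (u, some k), sq]

/-- A polynomial that is bounded in its block degrees and has a multihomogenization that does
not vanish at infinity attains these degrees in one monomial. -/
theorem exists_top_monomial {U I : Type*} [Fintype U] [DecidableEq U] [Fintype I] [DecidableEq I]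
    {D : U → ℕ} {f : MvPolynomial (U × I) ℂ} (hD : BlockDegreeLE D f) {x : U × I → ℂ}
    (hx : homEval D 0 x f ≠ 0) :
    (fun u => blockDegree u f) = D ∧ ∃ α ∈ f.support, ∀ u, ∑ i, α (u, i) = D u := by
  obtain ⟨α, hα, hαD⟩ := exists_mem_support_of_homEval_ne_zero hx
  have h1 : ∀ u, ∑ i, α (u, i) = D u := fun u => le_antisymm (hD α hα u) (hαD u rfl)
  refine ⟨funext fun u => le_antisymm ?_ ?_, α, hα, h1⟩
  · exact Finset.sup_le fun β hβ => hD β hβ u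
  · rw [← h1 u]
    exact blockDegreeLE_blockDegree f α hα u

theorem top_magnitudeEquation (hd : 0 < d) (u : FreeVertex K) :
    (fun v => blockDegree v (sphereEquations G K p lam (Sum.inl u))) =
      Pi.single u 1 + Pi.single u 1 ∧
    ∃ α ∈ (sphereEquations G K p lam (Sum.inl u)).support, ∀ v, ∑ i, α (v, i) =
      (Pi.single u 1 + Pi.single u 1 : FreeVertex K → ℕ) v := by
  refine exists_top_monomial (x := Pi.single (u, some ⟨0, hd⟩) 1)
    (blockDegreeLE_magnitudeEquation K u) ?_
  have := homEval_magnitudeEquation K 0 (Pi.single (u, some (⟨0, hd⟩ : Fin d)) 1) u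
  simp only [sphereEquations, Sum.elim_inl]
  rw [this]
  simp [Pi.single_apply]

/-- At `h = 0` there remains `-2⟨x_u, x_v⟩` for two free ends, and `s_u - 2⟨x_u, p_v⟩` if only `u`
is free. -/
theorem exists_homEdge_ne_zero (hd : 0 < d) (l : ℂ) {u v : V}
    (hfree : u ∉ K ∨ v ∉ K) : ∃ x, homEdge K p l 0 x u v ≠ 0 := by
  have key : ∀ u v, u ∉ K → ∃ x, homEdge K p l 0 x u v ≠ 0 := by
    intro u v hu
    by_cases hv : v ∈ K
    · refine ⟨Pi.single (⟨u, hu⟩, none) 1, ?_⟩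
      simp [homEdge, homCoord, magnitudeValue, coordValue, hu, hv]
    · refine ⟨fun _ => 1, ?_⟩
      simp [homEdge, homCoord, magnitudeValue, coordValue, hu, hv, hd.ne']
  rcases hfree with hu | hv
  · exact key u v hu
  · obtain ⟨x, hx⟩ := key v u hv
    refine ⟨x, ?_⟩
    convert hx using 1
    unfold homEdge
    simp only [mul_comm (coordValue K p x u _)]
    ring

theorem top_edgePolynomial (hd : 0 < d) (e : FreeEdge G K) {u v : V} (he : e.1 = s(u, v)) :
    (fun w => blockDegree w (sphereEquations G K p lam (Sum.inr e))) =
      vertexDegree K u + vertexDegree K v ∧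
    ∃ α ∈ (sphereEquations G K p lam (Sum.inr e)).support, ∀ w, ∑ i, α (w, i) =
      (vertexDegree K u + vertexDegree K v) w := by
  obtain ⟨hadj, w, hw, hwK⟩ := e.2
  rw [he] at hadj hw
  have hfree : u ∉ K ∨ v ∉ K := by
    rcases Sym2.mem_iff.1 hw with rfl | rfl
    · exact Or.inl hwK
    · exact Or.inr hwK
  obtain ⟨x, hx⟩ := exists_homEdge_ne_zero K p hd (lam e) hfree
  simp only [sphereEquations, Sum.elim_inr, he]
  refine exists_top_monomial (x := x) (blockDegreeLE_edgePolynomial K p _ u v) ?_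
  rwa [homEval_edgePolynomial]

/-- A single monomial of each equation attains the degrees of all blocks at once, whatever `B` is.
-/
theorem leadSupport_sphereEquations_nonempty (hd : 0 < d) (B : Finset (FreeVertex K))
    (j : FreeVertex K ⊕ FreeEdge G K) : (leadSupport B ∅ (sphereEquations G K p lam j)).Nonempty := by
  have key : ∀ D, ((fun v => blockDegree v (sphereEquations G K p lam j)) = D ∧
      ∃ α ∈ (sphereEquations G K p lam j).support, ∀ v, ∑ i, α (v, i) = D v) →
      (leadSupport B ∅ (sphereEquations G K p lam j)).Nonempty := by
    rintro D ⟨rfl, α, hα, hαD⟩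
    exact ⟨α, Finset.mem_filter.2 ⟨hα, fun u _ => hαD u, by simp⟩⟩
  rcases j with u | e
  · exact key _ (top_magnitudeEquation G K p lam hd u)
  · obtain ⟨⟨u, v⟩, he⟩ := Quot.exists_rep e.1
    exact key _ (top_edgePolynomial G K p lam hd e he.symm)

theorem homEval_sphereEquations_eq_zero_iff (hd : 0 < d) (h : FreeVertex K → ℂ)
    (x : Var K d → ℂ) :
    (∀ j, homEval (fun v => blockDegree v (sphereEquations G K p lam j)) h x
      (sphereEquations G K p lam j) = 0) ↔ IsHomSolution G K p lam h x := by
  unfold IsHomSolution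
  rw [Sum.forall]
  refine and_congr (forall_congr' fun u => ?_) ⟨fun H e u v he => ?_, fun H e => ?_⟩
  · rw [(top_magnitudeEquation G K p lam hd u).1]
    have := homEval_magnitudeEquation K h x u
    simp only [sphereEquations, Sum.elim_inl]
    rw [this, sub_eq_zero]
  · have := H e
    rw [(top_edgePolynomial G K p lam hd e he).1] at this
    rw [sphereEquations, Sum.elim_inr, he] at this
    rwa [homEval_edgePolynomial] at this
  · obtain ⟨⟨u, v⟩, he⟩ := Quot.exists_rep e.1
    have he : e.1 = s(u, v) := he.symm
    rw [(top_edgePolynomial G K p lam hd e he).1]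
    simp only [sphereEquations, Sum.elim_inr, he]
    rw [homEval_edgePolynomial]
    exact H e u v he

theorem sum_blockDegree_pos (hd : 0 < d) (u : FreeVertex K) :
    0 < ∑ j, blockDegree u (sphereEquations G K p lam j) := by
  refine lt_of_lt_of_le ?_ (Finset.single_le_sum (f := fun j =>
    blockDegree u (sphereEquations G K p lam j)) (fun _ _ => Nat.zero_le _)
      (Finset.mem_univ (Sum.inl u)))
  have := congrFun (top_magnitudeEquation G K p lam hd u).1 u
  rw [this]
  simp

variable {G K p lam}

theorem IsHomSolution.scale {h : FreeVertex K → ℂ} {x : Var K d → ℂ} (hd : 0 < d)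
    (H : IsHomSolution G K p lam h x) (c : FreeVertex K → ℂ) :
    IsHomSolution G K p lam (fun u => c u * h u) (fun a => c a.1 * x a) := by
  rw [← homEval_sphereEquations_eq_zero_iff G K p lam hd] at H ⊢
  intro j
  rw [homEval_scale (blockDegreeLE_blockDegree _), H j, mul_zero]

/-- This is translation by `a`, cleared of denominators. It remains meaningful at infinity, where it
fixes the `x_u` and changes `s_u` by `2⟨x_u, a⟩`. -/
theorem IsHomSolution.translate {h : FreeVertex K → ℂ} {x : Var K d → ℂ}
    (H : IsHomSolution G K p lam h x) (a : Fin d → ℂ) :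
    IsHomSolution G K (fun v k => p v k + a k) lam h
      (fun b => b.2.elim (x b + 2 * ∑ k, x (b.1, some k) * a k + h b.1 * ∑ k, a k ^ 2)
        fun k => x b + h b.1 * a k) := by
  set x' : Var K d → ℂ := fun b =>
    b.2.elim (x b + 2 * ∑ k, x (b.1, some k) * a k + h b.1 * ∑ k, a k ^ 2)
        fun k => x b + h b.1 * a k
  have hc : ∀ v k, coordValue K (fun v k => p v k + a k) x' v k =
      coordValue K p x v k + homCoord K h v * a k := by
    intro v k
    unfold coordValue homCoord
    split_ifs <;> simp [x']
  have hm : ∀ v, magnitudeValue K (fun v k => p v k + a k) x' v =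
      magnitudeValue K p x v + 2 * ∑ k, coordValue K p x v k * a k +
        homCoord K h v * ∑ k, a k ^ 2 := by
    intro v
    unfold magnitudeValue coordValue homCoord
    split_ifs
    · simp only [add_sq, Finset.sum_add_distrib, Finset.mul_sum, one_mul, mul_assoc]
    · simp [x']
  refine ⟨fun u => ?_, fun e u v he => ?_⟩
  · simp only [x', Option.elim, add_sq, Finset.sum_add_distrib, H.1 u, mul_pow, ← Finset.mul_sum]
    have : ∑ k, 2 * x (u, some k) * (h u * a k) = 2 * h u * ∑ k, x (u, some k) * a k := by
      rw [Finset.mul_sum]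
      exact Finset.sum_congr rfl fun k _ => by ring
    rw [this]
    ring
  · have := H.2 e u v he
    unfold homEdge at this ⊢
    simp only [hc, hm]
    have h1 : ∑ k, (coordValue K p x u k + homCoord K h u * a k) *
        (coordValue K p x v k + homCoord K h v * a k) =
        ∑ k, coordValue K p x u k * coordValue K p x v k +
        homCoord K h v * ∑ k, coordValue K p x u k * a k +
        homCoord K h u * ∑ k, coordValue K p x v k * a k +
        homCoord K h u * homCoord K h v * ∑ k, a k ^ 2 := by
      simp only [Finset.mul_sum, ← Finset.sum_add_distrib]
      exact Finset.sum_congr rfl fun k _ => by ring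
    rw [h1]
    linear_combination this

/-- The equations see the points only through the bilinear form, so its preservation is all that is
needed of `A`. -/
theorem IsHomSolution.isometry {h : FreeVertex K → ℂ} {x : Var K d → ℂ}
    (H : IsHomSolution G K p lam h x) (A : (Fin d → ℂ) → Fin d → ℂ)
    (hA : ∀ y z, ∑ k, A y k * A z k = ∑ k, y k * z k) :
    IsHomSolution G K (fun v => A (p v)) lam h
      (fun b => b.2.elim (x b) fun k => A (fun k => x (b.1, some k)) k) := by
  set x' : Var K d → ℂ := fun b => b.2.elim (x b) fun k => A (fun k => x (b.1, some k)) k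
  have hsq : ∀ y, ∑ k, A y k ^ 2 = ∑ k, y k ^ 2 := by
    intro y
    simpa only [sq] using hA y y
  have hc : ∀ v, coordValue K (fun v => A (p v)) x' v = A (coordValue K p x v) := by
    intro v
    ext k
    unfold coordValue
    split_ifs <;> simp [x']
  have hm : ∀ v, magnitudeValue K (fun v => A (p v)) x' v = magnitudeValue K p x v := by
    intro v
    unfold magnitudeValue
    split_ifs
    · exact hsq _
    · simp [x']
  refine ⟨fun u => ?_, fun e u v he => ?_⟩
  · simp only [x', Option.elim, hsq]
    exact H.1 u
  · have := H.2 e u v he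
    unfold homEdge at this ⊢
    simp only [hc, hm, hA]
    exact this

end HomogeneousSystem

/-! ### Complex plane rotations -/

section Rotation

variable {d : ℕ}

/-- The rotation by the angle `θ` in the plane of the coordinates `j` and `k`. -/
noncomputable def planeRotation (j k : Fin d) (θ : ℂ) (y : Fin d → ℂ) (l : Fin d) : ℂ :=
  if l = j then Complex.cos θ * y j - Complex.sin θ * y k
  else if l = k then Complex.sin θ * y j + Complex.cos θ * y k else y l

theorem sum_planeRotation_mul {j k : Fin d} (hjk : j ≠ k) (θ : ℂ) (y z : Fin d → ℂ) :
    ∑ l, planeRotation j k θ y l * planeRotation j k θ z l = ∑ l, y l * z l := by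
  rw [← sub_eq_zero, ← Finset.sum_sub_distrib,
    ← Finset.sum_subset (Finset.subset_univ {j, k}) fun l _ hl => ?_, Finset.sum_pair hjk]
  · simp only [planeRotation, if_true, if_neg hjk.symm]
    linear_combination (y j * z j + y k * z k) * Complex.sin_sq_add_cos_sq θ
  · simp only [Finset.mem_insert, Finset.mem_singleton, not_or] at hl
    simp [planeRotation, hl.1, hl.2]

end Rotation

end SphereEquations

namespace SphereEquations

/-! ### Solutions for generic parameters -/

section GenericPosition

set_option linter.unusedSectionVars false

open MvPolynomial Topology

variable {V : Type*} [Fintype V] [DecidableEq V] {G : SimpleGraph V} {K : Finset V} {d : ℕ}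

/-- The homogenizing coordinates of the points for which exactly the vertices of `B` lie at
infinity. -/
def finiteIndicator (B : Finset (FreeVertex K)) (u : FreeVertex K) : ℂ := if u ∈ B then 0 else 1

/-- The evaluation point of the parameters. -/
def params (p : {v : V // v ∈ K} → Fin d → ℂ) (lam : FreeEdge G K → ℂ) :
    ({v : V // v ∈ K} × Fin d) ⊕ FreeEdge G K → ℂ :=
  Sum.elim (fun a => p a.1 a.2) lam

/-- A continuous deformation of a solution that makes a zero coordinate nonzero. -/
theorem exists_fewer_zeros (Q : MvPolynomial (({v : V // v ∈ K} × Fin d) ⊕ FreeEdge G K) ℂ)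
    (lam : FreeEdge G K → ℂ) (h : FreeVertex K → ℂ)
    (p : ℂ → {v : V // v ∈ K} → Fin d → ℂ) (x : ℂ → Var K d → ℂ)
    (hp : Continuous p) (hx : Continuous x) (H : ∀ θ, IsHomSolution G K (p θ) lam h (x θ))
    (hQ : eval (params (p 0) lam) Q ≠ 0) (a : Var K d) (ha0 : x 0 a = 0)
    (ha : ∀ᶠ θ in 𝓝[≠] 0, x θ a ≠ 0) :
    ∃ p' x', IsHomSolution G K p' lam h x' ∧ eval (params p' lam) Q ≠ 0 ∧
      (Finset.univ.filter fun b => x' b = 0) ⊂ Finset.univ.filter fun b => x 0 b = 0 := by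
  have hpar : Continuous fun θ => params (p θ) lam := by
    refine continuous_pi fun i => ?_
    rcases i with i | i
    · exact (continuous_apply i.2).comp ((continuous_apply i.1).comp hp)
    · exact continuous_const
  -- For small nonzero `θ` the parameters stay off `Q = 0`, nonzero coordinates stay nonzero, and
  -- the coordinate `a` becomes nonzero.
  have h1 : ∀ᶠ θ in 𝓝[≠] (0 : ℂ), eval (params (p θ) lam) Q ≠ 0 :=
    nhdsWithin_le_nhds (((MvPolynomial.continuous_eval Q).comp hpar).continuousAt.eventually_ne hQ)
  have h2 : ∀ᶠ θ in 𝓝[≠] (0 : ℂ), ∀ b, x 0 b ≠ 0 → x θ b ≠ 0 := by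
    refine nhdsWithin_le_nhds (Filter.eventually_all.2 fun b => ?_)
    by_cases hb : x 0 b = 0
    · simp [hb]
    · have := ((continuous_apply b).comp hx).continuousAt.eventually_ne (x := 0) hb
      filter_upwards [this] with θ hθ _ using hθ
  obtain ⟨θ, ⟨hθ1, hθ2⟩, hθ3⟩ := ((h1.and h2).and ha).exists
  refine ⟨p θ, x θ, H θ, hθ1, ?_⟩
  rw [Finset.ssubset_iff_of_subset]
  · exact ⟨a, by simp [ha0], by simp [hθ3]⟩
  · intro b hb
    simp only [Finset.mem_filter, Finset.mem_univ, true_and] at hb ⊢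
    by_contra hb'
    exact hθ2 b hb' hb

/-- The expression in `ha` is the change of the coordinate `a` under translation by `θ` along the
`k`-th axis. -/
theorem IsHomSolution.exists_fewer_zeros_translate
    (Q : MvPolynomial (({v : V // v ∈ K} × Fin d) ⊕ FreeEdge G K) ℂ)
    {p : {v : V // v ∈ K} → Fin d → ℂ} {lam : FreeEdge G K → ℂ} {h : FreeVertex K → ℂ}
    {x : Var K d → ℂ} (H : IsHomSolution G K p lam h x) (hQ : eval (params p lam) Q ≠ 0)
    (k : Fin d) (a : Var K d) (ha0 : x a = 0)
    (ha : ∀ᶠ θ in 𝓝[≠] (0 : ℂ), (a.2.elim (2 * (x (a.1, some k) * θ) + h a.1 * θ ^ 2)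
      fun l => h a.1 * if l = k then θ else 0) ≠ 0) :
    ∃ p' x', IsHomSolution G K p' lam h x' ∧ eval (params p' lam) Q ≠ 0 ∧
      (Finset.univ.filter fun b => x' b = 0) ⊂ Finset.univ.filter fun b => x b = 0 := by
  let δ : ℂ → Fin d → ℂ := fun θ l => if l = k then θ else 0
  have hδ : Continuous δ := by
    refine continuous_pi fun l => ?_
    by_cases hl : l = k
    · simp only [δ, if_pos hl]; exact continuous_id
    · simp only [δ, if_neg hl]; exact continuous_const
  let X : ℂ → Var K d → ℂ := fun θ b =>
    b.2.elim (x b + 2 * ∑ k, x (b.1, some k) * δ θ k + h b.1 * ∑ k, δ θ k ^ 2)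
      fun k => x b + h b.1 * δ θ k
  have hX0 : X 0 = x := by
    ext ⟨u, _ | l⟩ <;> simp [X, δ]
  have hX : Continuous X := by
    refine continuous_pi fun b => ?_
    have hδ' : ∀ l, Continuous fun θ => δ θ l := fun l => (continuous_apply l).comp hδ
    rcases b with ⟨u, _ | l⟩
    · simp only [X, Option.elim]
      fun_prop
    · simp only [X, Option.elim]
      fun_prop
  have := exists_fewer_zeros Q lam h (fun θ v l => p v l + δ θ l) X
    (by
      refine continuous_pi fun v => continuous_pi fun l => ?_
      exact continuous_const.add ((continuous_apply l).comp hδ))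
    hX (fun θ => H.translate (δ θ)) (by simpa [δ] using hQ) a (by rw [hX0]; exact ha0) ?_
  · rwa [hX0] at this
  · filter_upwards [ha] with θ hθ
    rcases a with ⟨u, _ | l⟩
    · simpa [X, δ, ha0, ite_pow] using hθ
    · simpa [X, δ, ha0] using hθ

/-- Needed for vertices at infinity, whose `x`-coordinates no translation moves. Rotation in the
plane of `j` and `k` turns the zero coordinate into `sin θ * x (u, some j)`. -/
theorem IsHomSolution.exists_fewer_zeros_rotate
    (Q : MvPolynomial (({v : V // v ∈ K} × Fin d) ⊕ FreeEdge G K) ℂ)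
    {p : {v : V // v ∈ K} → Fin d → ℂ} {lam : FreeEdge G K → ℂ} {h : FreeVertex K → ℂ}
    {x : Var K d → ℂ} (H : IsHomSolution G K p lam h x) (hQ : eval (params p lam) Q ≠ 0)
    (u : FreeVertex K) (j k : Fin d) (hk : x (u, some k) = 0) (hj : x (u, some j) ≠ 0) :
    ∃ p' x', IsHomSolution G K p' lam h x' ∧ eval (params p' lam) Q ≠ 0 ∧
      (Finset.univ.filter fun b => x' b = 0) ⊂ Finset.univ.filter fun b => x b = 0 := by
  have hjk : j ≠ k := by rintro rfl; exact hj hk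
  have hrot : ∀ y : Fin d → ℂ, Continuous fun θ => planeRotation j k θ y := by
    intro y
    refine continuous_pi fun l => ?_
    unfold planeRotation
    split_ifs <;> fun_prop
  have hrot0 : ∀ y : Fin d → ℂ, planeRotation j k 0 y = y := by
    intro y
    ext l
    unfold planeRotation
    split_ifs with h1 h2 <;> simp [*]
  let X : ℂ → Var K d → ℂ := fun θ b =>
    b.2.elim (x b) fun l => planeRotation j k θ (fun k => x (b.1, some k)) l
  have hX0 : X 0 = x := by
    ext ⟨v, _ | l⟩ <;> simp [X, hrot0]
  have hX : Continuous X := by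
    refine continuous_pi fun b => ?_
    rcases b with ⟨v, _ | l⟩
    · exact continuous_const
    · exact (continuous_apply l).comp (hrot _)
  have := exists_fewer_zeros Q lam h (fun θ v => planeRotation j k θ (p v)) X
    (continuous_pi fun v => hrot (p v)) hX
    (fun θ => H.isometry _ fun y z => sum_planeRotation_mul hjk θ y z)
    (by simpa only [hrot0] using hQ) (u, some k) (by rw [hX0]; exact hk) ?_
  · rwa [hX0] at this
  · have hsin := (Complex.hasDerivAt_sin 0).eventually_ne (c := 0) (by simp)
    filter_upwards [hsin] with θ hθ
    simp [X, planeRotation, hjk.symm, hk, hj, hθ]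

/-- A solution at infinity can be moved by isometries to a solution with nonzero coordinates. -/
theorem exists_isHomSolution_torus (hd : 0 < d)
    (Q : MvPolynomial (({v : V // v ∈ K} × Fin d) ⊕ FreeEdge G K) ℂ)
    (p : {v : V // v ∈ K} → Fin d → ℂ) (lam : FreeEdge G K → ℂ) (B : Finset (FreeVertex K))
    (x : Var K d → ℂ) (H : IsHomSolution G K p lam (finiteIndicator B) x)
    (hB : ∀ u ∈ B, ∃ k, x (u, some k) ≠ 0) (hQ : eval (params p lam) Q ≠ 0) :
    ∃ p' x', IsHomSolution G K p' lam (finiteIndicator B) x' ∧ eval (params p' lam) Q ≠ 0 ∧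
      ∀ a, x' a ≠ 0 := by
  induction hn : (Finset.univ.filter fun b => x b = 0) using Finset.strongInduction
    generalizing p x with
  | H s ih =>
    subst hn
    by_cases hzero : ∃ a, x a = 0
    · suffices ∃ p' x', IsHomSolution G K p' lam (finiteIndicator B) x' ∧
          eval (params p' lam) Q ≠ 0 ∧
          (Finset.univ.filter fun b => x' b = 0) ⊂ Finset.univ.filter fun b => x b = 0 by
        obtain ⟨p', x', H', hQ', hlt⟩ := this
        -- Zeros only disappear, so the vertices of `B` keep a nonzero `x`-coordinate.
        refine ih _ hlt p' x' H' (fun u hu => ?_) hQ' rfl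
        obtain ⟨k, hk⟩ := hB u hu
        refine ⟨k, fun h0 => hk ?_⟩
        have := hlt.1 (Finset.mem_filter.2 ⟨Finset.mem_univ (u, some k), h0⟩)
        exact (Finset.mem_filter.1 this).2
      obtain ⟨⟨u, o⟩, ha⟩ := hzero
      have hne : ∀ᶠ θ in 𝓝[≠] (0 : ℂ), θ ≠ 0 := self_mem_nhdsWithin
      by_cases hu : u ∈ B
      · obtain ⟨j, hj⟩ := hB u hu
        rcases o with _ | k
        · refine H.exists_fewer_zeros_translate Q hQ j (u, none) ha ?_
          filter_upwards [hne] with θ hθ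
          simp [finiteIndicator, hu, hj, hθ]
        · exact H.exists_fewer_zeros_rotate Q hQ u j k ha hj
      · rcases o with _ | k
        · refine H.exists_fewer_zeros_translate Q hQ ⟨0, hd⟩ (u, none) ha ?_
          -- For a finite vertex the translated magnitude is `θ * (2 * x (u, some ⟨0, hd⟩) + θ)`;
          -- the second root is avoided as well.
          have h1 : ∀ᶠ θ in 𝓝[≠] (0 : ℂ), θ ≠ -(2 * x (u, some ⟨0, hd⟩)) := by
            by_cases h0 : x (u, some ⟨0, hd⟩) = 0
            · simpa [h0] using hne
            · exact nhdsWithin_le_nhds (continuousAt_id.eventually_ne (by simpa [eq_comm] using h0))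
          filter_upwards [hne, h1] with θ hθ hθ1
          simp only [Option.elim, finiteIndicator, hu, if_false, one_mul]
          intro h2
          have h3 : θ * (2 * x (u, some ⟨0, hd⟩) + θ) = 0 := by linear_combination h2
          rcases mul_eq_zero.1 h3 with h4 | h4
          · exact hθ h4
          · exact hθ1 (by linear_combination h4)
        · refine H.exists_fewer_zeros_translate Q hQ k (u, some k) ha ?_
          filter_upwards [hne] with θ hθ
          simpa [finiteIndicator, hu] using hθ
    · push Not at hzero
      exact ⟨p, x, H, hQ, hzero⟩

/-- The system at infinity as polynomials in the parameters and the variables. -/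
theorem exists_polynomials_isHomSolution (B : Finset (FreeVertex K)) :
    ∃ f : FreeVertex K ⊕ (FreeEdge G K × V × V) →
        MvPolynomial ((({v : V // v ∈ K} × Fin d) ⊕ FreeEdge G K) ⊕ Var K d) ℂ,
      ∀ p lam x, (∀ j, eval (Sum.elim (params p lam) x) (f j) = 0) ↔
        IsHomSolution G K p lam (finiteIndicator B) x := by
  classical
  let cP : V → Fin d → MvPolynomial ((({v : V // v ∈ K} × Fin d) ⊕ FreeEdge G K) ⊕ Var K d) ℂ :=
    fun v k => if hv : v ∈ K then X (Sum.inl (Sum.inl (⟨v, hv⟩, k)))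
      else X (Sum.inr (⟨v, hv⟩, some k))
  let sP : V → MvPolynomial ((({v : V // v ∈ K} × Fin d) ⊕ FreeEdge G K) ⊕ Var K d) ℂ :=
    fun v => if hv : v ∈ K then ∑ k, X (Sum.inl (Sum.inl (⟨v, hv⟩, k))) ^ 2
      else X (Sum.inr (⟨v, hv⟩, none))
  have hc : ∀ p lam x v k, eval (Sum.elim (params p lam) x) (cP v k) = coordValue K p x v k := by
    intro p lam x v k
    simp only [cP, coordValue]
    split_ifs <;> simp [params]
  have hs : ∀ p lam x v, eval (Sum.elim (params p lam) x) (sP v) = magnitudeValue K p x v := by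
    intro p lam x v
    simp only [sP, magnitudeValue]
    split_ifs <;> simp [params]
  have hpar : ∀ p lam e, params (d := d) (K := K) (G := G) p lam (Sum.inr e) = lam e :=
    fun _ _ _ => rfl
  refine ⟨Sum.elim
    (fun u => ∑ k : Fin d, X (Sum.inr (u, some k)) ^ 2 -
      X (Sum.inr (u, none)) * C (finiteIndicator B u))
    (fun euv => if euv.1.1 = s(euv.2.1, euv.2.2) then
      sP euv.2.1 * C (homCoord K (finiteIndicator B) euv.2.2) +
      sP euv.2.2 * C (homCoord K (finiteIndicator B) euv.2.1) -
      2 * ∑ k, cP euv.2.1 k * cP euv.2.2 k -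
      X (Sum.inl (Sum.inr euv.1)) ^ 2 * C (homCoord K (finiteIndicator B) euv.2.1 *
        homCoord K (finiteIndicator B) euv.2.2) else 0), fun p lam x => ?_⟩
  unfold IsHomSolution
  rw [Sum.forall]
  refine and_congr (forall_congr' fun u => ?_) ⟨fun h e u v he => ?_, fun h => ?_⟩
  · simp [sub_eq_zero]
  · have := h (e, u, v)
    simp only [Sum.elim_inr, if_pos he] at this
    simpa [hc, hs, hpar, homEdge] using this
  · rintro ⟨e, u, v⟩
    simp only [Sum.elim_inr]
    split_ifs with he
    · simpa [hc, hs, hpar, homEdge] using h e u v he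
    · simp

/-- For generic parameters, if the system with the vertices of `B` at infinity is solvable, it
is solvable with nonzero coordinates. -/
theorem exists_generic_torus (hd : 0 < d) (B : Finset (FreeVertex K)) :
    ∃ Q : MvPolynomial (({v : V // v ∈ K} × Fin d) ⊕ FreeEdge G K) ℂ, Q ≠ 0 ∧
      ∀ p lam, eval (params p lam) Q ≠ 0 →
        (∃ x, IsHomSolution G K p lam (finiteIndicator B) x ∧
          ∀ u ∈ B, ∃ k, x (u, some k) ≠ 0) →
        ∃ x, IsHomSolution G K p lam (finiteIndicator B) x ∧ ∀ a, x a ≠ 0 := by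
  obtain ⟨f, hf⟩ := exists_polynomials_isHomSolution (G := G) (d := d) B
  obtain ⟨Q, hQ, h | h⟩ := exists_generic_dichotomy_torus f
  · refine ⟨Q, hQ, fun p lam hpl _ => ?_⟩
    obtain ⟨x, hx0, hx⟩ := h _ hpl
    exact ⟨x, (hf p lam x).1 hx, hx0⟩
  -- If the torus system is unsolvable wherever `Q ≠ 0`, a solution moved into the torus within that
  -- set is a contradiction.
  · refine ⟨Q, hQ, fun p lam hpl ⟨x, H, hB⟩ => ?_⟩
    obtain ⟨p', x', H', hQ', h0⟩ := exists_isHomSolution_torus hd Q p lam B x H hB hpl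
    exact absurd ⟨x', h0, (hf p' lam x').2 H'⟩ (h _ hQ')

/-- For generic parameters, the finite solutions have nonzero coordinates. -/
theorem exists_generic_finite_ne_zero (hd : 0 < d)
    (hcard : Fintype.card (FreeVertex K × Fin d) ≤ Fintype.card (FreeEdge G K)) (a : Var K d) :
    ∃ Q : MvPolynomial (({v : V // v ∈ K} × Fin d) ⊕ FreeEdge G K) ℂ, Q ≠ 0 ∧
      ∀ p lam, eval (params p lam) Q ≠ 0 →
        ∀ x, IsHomSolution G K p lam 1 x → x a ≠ 0 := by
  let cP : V → Fin d → MvPolynomial (({v : V // v ∈ K} × Fin d) ⊕ (FreeVertex K × Fin d)) ℂ :=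
    fun v k => if hv : v ∈ K then X (Sum.inl (⟨v, hv⟩, k)) else X (Sum.inr (⟨v, hv⟩, k))
  let f : ({v : V // v ∈ K} × Fin d) ⊕ FreeEdge G K →
      MvPolynomial (({v : V // v ∈ K} × Fin d) ⊕ (FreeVertex K × Fin d)) ℂ :=
    Sum.elim (fun b => X (Sum.inl b))
      fun e => ∑ k, (cP (Quot.out e.1).1 k - cP (Quot.out e.1).2 k) ^ 2
  -- The magnitude of a finite vertex is the sum of its squared coordinates, so magnitudes need no
  -- variables here. The map `f` sends all point positions to the fixed points and the squared edge
  -- lengths.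
  let g : MvPolynomial (({v : V // v ∈ K} × Fin d) ⊕ (FreeVertex K × Fin d)) ℂ :=
    a.2.elim (∑ k, X (Sum.inr (a.1, k)) ^ 2) fun k => X (Sum.inr (a.1, k))
  have hg : g ≠ 0 := by
    intro h0
    rcases a with ⟨u, _ | k⟩
    · have := congrArg (eval (Pi.single (Sum.inr (u, (⟨0, hd⟩ : Fin d))) 1)) h0
      simp [g, Pi.single_apply] at this
    · exact X_ne_zero _ h0
  obtain ⟨Q₁, hQ₁, hvan⟩ := exists_vanishing_on_image f g hg (by
    rw [Fintype.card_sum, Fintype.card_sum]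
    omega)
  let Q : MvPolynomial (({v : V // v ∈ K} × Fin d) ⊕ FreeEdge G K) ℂ :=
    bind₁ (Sum.elim (fun b => X (Sum.inl b)) fun e => X (Sum.inr e) ^ 2) Q₁
  have hQeval : ∀ p lam, eval (params p lam) Q =
      eval (params p fun e : FreeEdge G K => lam e ^ 2) Q₁ := by
    intro p lam
    refine (eval₂Hom_bind₁ (RingHom.id ℂ) (params p lam) _ Q₁).trans ?_
    refine congrArg (fun z => eval z Q₁) (funext fun i => ?_)
    rcases i with i | i <;> simp [params]
  refine ⟨Q, fun h0 => hQ₁ ?_, fun p lam hpl x H hxa => hpl ?_⟩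
  · refine MvPolynomial.funext fun y => ?_
    -- `Q` is `Q₁` with squared lengths substituted; it is nonzero because every complex number is a
    -- square.
    have hsqrt : ∀ e, ∃ l : ℂ, l ^ 2 = y (Sum.inr e) :=
      fun e => IsAlgClosed.exists_pow_nat_eq _ two_pos
    choose lam hlam using hsqrt
    have h1 := hQeval (fun v k => y (Sum.inl (v, k))) lam
    rw [h0, map_zero] at h1
    rw [map_zero, h1]
    refine congrArg (fun z => eval z Q₁) (funext fun i => ?_)
    rcases i with i | i
    · rfl
    · exact (hlam i).symm
  · rw [hQeval]
    let z : ({v : V // v ∈ K} × Fin d) ⊕ (FreeVertex K × Fin d) → ℂ :=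
      Sum.elim (fun b => p b.1 b.2) fun b => x (b.1, some b.2)
    have hcP : ∀ v k, eval z (cP v k) = coordValue K p x v k := by
      intro v k
      simp only [cP, coordValue]
      split_ifs <;> simp [z]
    have hmag : ∀ v, magnitudeValue K p x v = ∑ k, coordValue K p x v k ^ 2 := by
      intro v
      unfold magnitudeValue coordValue
      split_ifs with hv
      · rfl
      · rw [H.1 ⟨v, hv⟩, Pi.one_apply, mul_one]
    have hone : ∀ v, homCoord K 1 v = 1 := by
      intro v
      simp [homCoord]
    have hz : params p (fun e : FreeEdge G K => lam e ^ 2) = fun i => eval z (f i) := by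
      funext i
      rcases i with i | e
      · simp [params, f, z]
      · have he : e.1 = s((Quot.out e.1).1, (Quot.out e.1).2) := (Quot.out_eq e.1).symm
        have := H.2 e _ _ he
        simp only [homEdge, hmag, hone] at this
        simp only [params, Sum.elim_inr, f, map_sum, map_pow, map_sub, hcP]
        simp only [sub_sq, Finset.sum_add_distrib, Finset.sum_sub_distrib, mul_assoc,
          ← Finset.mul_sum]
        linear_combination -this
    rw [hz]
    apply hvan
    rcases a with ⟨u, _ | k⟩
    · simpa [g, z, hxa] using H.1 u
    · simpa [g, z] using hxa

end GenericPosition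

end SphereEquations

namespace SphereEquations

/-! ### Zero evaluations versus Bernstein's condition -/

section Checks

set_option linter.unusedSectionVars false

open MvPolynomial

variable {V : Type*} [Fintype V] [DecidableEq V] {G : SimpleGraph V} {K : Finset V} {d : ℕ}
  {p : {v : V // v ∈ K} → Fin d → ℂ} {lam : FreeEdge G K → ℂ}

theorem zeroEvaluationSolvable_iff_exists_hom (hd : 0 < d) (L : FreeVertex K → Fin d)
    (u : FreeVertex K) :
    ZeroEvaluationSolvable G K p lam L u ↔ ∃ t : Var K d → ℂ, t (u, some (L u)) = 0 ∧
      IsHomSolution G K p lam (fun v => t (v, some (L v)))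
        (fun a => if a.2 = some (L a.1) then 1 else t a) := by
  simp only [← homEval_sphereEquations_eq_zero_iff G K p lam hd, ZeroEvaluationSolvable,
    eval_deltaTransform]

/-- The zero evaluation of `F̃_L` at `u` is solvable if and only if the sphere equations have a
solution for which the vertices of some set `B` containing `u` lie at infinity and the coordinates
chosen by `L` do not vanish. -/
theorem zeroEvaluationSolvable_iff (hd : 0 < d) (L : FreeVertex K → Fin d) (u : FreeVertex K) :
    ZeroEvaluationSolvable G K p lam L u ↔ ∃ (B : Finset (FreeVertex K)) (x : Var K d → ℂ),
      u ∈ B ∧ IsHomSolution G K p lam (finiteIndicator B) x ∧ ∀ v, x (v, some (L v)) ≠ 0 := by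
  rw [zeroEvaluationSolvable_iff_exists_hom hd]
  constructor
  · rintro ⟨t, htu, H⟩
    -- Blocks with nonzero δ-variable are rescaled to `h = 1`; the others already lie at infinity
    -- and form `B`.
    let c : FreeVertex K → ℂ := fun v => if t (v, some (L v)) = 0 then 1 else (t (v, some (L v)))⁻¹
    refine ⟨Finset.univ.filter fun v => t (v, some (L v)) = 0,
      fun a => c a.1 * if a.2 = some (L a.1) then 1 else t a, by simpa using htu, ?_, ?_⟩
    · convert H.scale hd c using 1
      ext v
      by_cases hv : t (v, some (L v)) = 0
      · simp [finiteIndicator, c, hv]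
      · simp [finiteIndicator, c, hv]
    · intro v
      simp only [if_true, mul_one, c]
      split_ifs with hv
      · exact one_ne_zero
      · exact inv_ne_zero hv
  · rintro ⟨B, x, hu, H, hx⟩
    let c : FreeVertex K → ℂ := fun v => (x (v, some (L v)))⁻¹
    refine ⟨fun a => if a.2 = some (L a.1) then c a.1 * finiteIndicator B a.1 else c a.1 * x a,
      by simp [finiteIndicator, hu], ?_⟩
    convert H.scale hd c using 1
    · ext v
      simp
    · ext ⟨v, o⟩
      by_cases ho : o = some (L v)
      · subst ho
        simp [c, hx]
      · simp [ho]

/-- The initial form of a magnitude equation in a direction in which the magnitude variable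
dominates has no zeros with nonzero coordinates. -/
theorem eval_initialForm_magnitude_ne_zero (u : FreeVertex K) (w : Var K d → ℤ)
    (hnone : w (u, none) = -1) (hsome : ∀ k, w (u, some k) = 0) (x : Var K d → ℂ)
    (hx : x (u, none) ≠ 0) :
    eval x (initialForm w (∑ k : Fin d, X (u, some k) ^ 2 - X (u, none))) ≠ 0 := by
  classical
  set f : MvPolynomial (Var K d) ℂ := ∑ k : Fin d, X (u, some k) ^ 2 - X (u, none) with hf
  set β : Var K d →₀ ℕ := Finsupp.single (u, none) 1 with hβ
  have hsq : ∀ k : Fin d, (X (u, some k) ^ 2 : MvPolynomial (Var K d) ℂ) =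
      monomial (Finsupp.single (u, some k) 2) 1 := fun k => X_pow_eq_monomial
  have hβ_ne : ∀ k : Fin d, Finsupp.single ((u, some k) : Var K d) 2 ≠ β := by
    intro k h
    have := DFunLike.congr_fun h ((u, none) : Var K d)
    simp [hβ] at this
  have hcoeff : f.coeff β = -1 := by
    rw [hf, coeff_sub, coeff_sum, X, hβ, coeff_monomial, if_pos rfl, Finset.sum_eq_zero, zero_sub]
    intro k _
    rw [hsq, coeff_monomial, if_neg (hβ_ne k)]
  have hβs : β ∈ f.support := by
    rw [mem_support_iff, hcoeff]
    norm_num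
  have hwβ : ∑ a, (β a : ℤ) * w a = -1 := by
    rw [Finset.sum_eq_single (u, none)]
    · simp [hβ, hnone]
    · intro b _ hb
      simp [hβ, hb]
    · simp
  have hw : ∀ α ∈ f.support, α ≠ β → ∑ a, (α a : ℤ) * w a = 0 := by
    intro α hα hne
    have hα' : ∃ k : Fin d, α = Finsupp.single (u, some k) 2 := by
      by_contra! h
      rw [mem_support_iff] at hα
      apply hα
      rw [hf, coeff_sub, coeff_sum, X, coeff_monomial, if_neg (Ne.symm hne), Finset.sum_eq_zero,
        sub_zero]
      intro k _
      rw [hsq, coeff_monomial, if_neg (Ne.symm (h k))]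
    obtain ⟨k, rfl⟩ := hα'
    rw [Finset.sum_eq_single (u, some k)]
    · simp [hsome]
    · intro b _ hb
      simp [hb]
    · simp
  have hfilter : f.support.filter
      (fun α => ∀ γ ∈ f.support, ∑ a, (α a : ℤ) * w a ≤ ∑ a, (γ a : ℤ) * w a) = {β} := by
    ext α
    simp only [Finset.mem_filter, Finset.mem_singleton]
    constructor
    · rintro ⟨hα, hmin⟩
      by_contra hne
      have := hmin β hβs
      rw [hwβ, hw α hα hne] at this
      omega
    · rintro rfl
      refine ⟨hβs, fun γ hγ => ?_⟩
      rw [hwβ]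
      by_cases hne : γ = β
      · rw [hne, hwβ]
      · rw [hw γ hγ hne]
        omega
  have : initialForm w f = monomial β (-1) := by
    rw [initialForm]
    rw [← hcoeff, ← Finset.sum_singleton (fun α => monomial α (f.coeff α)) β, ← hfilter]
  rw [this, eval_monomial]
  simpa [hβ] using hx

/-- A failure of Bernstein's condition yields a solution at infinity, or a finite solution with
a zero coordinate. -/
theorem exists_isHomSolution_of_not_bernsteinCondition (hd : 0 < d)
    (h : ¬ BernsteinCondition (sphereEquations G K p lam)) :
    ∃ (B : Finset (FreeVertex K)) (x : Var K d → ℂ),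
      IsHomSolution G K p lam (finiteIndicator B) x ∧
      (∀ u ∈ B, ∃ k, x (u, some k) ≠ 0) ∧ (B = ∅ → ∃ a, x a = 0) := by
  classical
  unfold BernsteinCondition at h
  push Not at h
  obtain ⟨w, hw, x, hx0, hx⟩ := h
  rw [mBezoutSum_eq _ (sum_blockDegree_pos G K p lam hd)] at hw
  have hc : ∀ u, (0 : ℝ) <
      ((∑ j, blockDegree u (sphereEquations G K p lam j) : ℕ) : ℝ) :=
    fun u => by exact_mod_cast sum_blockDegree_pos G K p lam hd u
  have hblock := faceNormals_simplexProduct_block hc hw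
  -- `B` is read off from `w`, not from the set of normals: a block normal together with all
  -- coordinate normals of its block cancels to zero.
  let B : Finset (FreeVertex K) := Finset.univ.filter fun u => ∃ i, w (u, i) = -1
  let Z : Finset (Var K d) :=
    Finset.univ.filter fun a => w a = (if a.1 ∈ B then -1 else 0) + 1
  have hB : ∀ u, u ∈ B ↔ ∃ i, w (u, i) = -1 := fun u => by simp [B]
  have hZ : ∀ a, a ∈ Z ↔ w a = (if a.1 ∈ B then -1 else 0) + 1 := fun a => by simp [Z]
  have hwB : ∀ u ∈ B, ∀ i, w (u, i) = -1 ∨ w (u, i) = 0 := by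
    intro u hu
    rcases hblock u with h | h
    · obtain ⟨i, hi⟩ := (hB u).1 hu
      rcases h i with h' | h' <;> omega
    · exact h
  have hwB' : ∀ u ∉ B, ∀ i, w (u, i) = 0 ∨ w (u, i) = 1 := by
    intro u hu i
    rcases hblock u with h | h
    · exact h i
    · rcases h i with h' | h'
      · exact absurd ((hB u).2 ⟨i, h'⟩) hu
      · exact Or.inl h'
  have hwBZ : ∀ a, w a = (if a.1 ∈ B then -1 else 0) + if a ∈ Z then 1 else 0 := by
    rintro ⟨u, i⟩
    simp only [hZ]
    by_cases hu : u ∈ B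
    · rcases hwB u hu i with h | h <;> simp [hu, h]
    · rcases hwB' u hu i with h | h <;> simp [hu, h]
  refine ⟨B, fun a => if a ∈ Z then 0 else x a, ?_, ?_, ?_⟩
  · rw [← homEval_sphereEquations_eq_zero_iff G K p lam hd]
    exact fun j => homEval_eq_zero_of_eval_initialForm B Z w hwBZ _ x (hx j)
  · intro u hu
    -- If all `x_{u,k}` were set to zero, `w` would vanish on them and equal -1 on `s_u`, so the
    -- initial form of the magnitude equation would be `-s_u`.
    by_contra! hall
    have hsome : ∀ k, w (u, some k) = 0 := by
      intro k
      have h1 : (u, some k) ∈ Z := by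
        by_contra h2
        have := hall k
        rw [if_neg h2] at this
        exact hx0 _ this
      have := (hZ _).1 h1
      simpa [hu] using this
    have hnone : w (u, none) = -1 := by
      obtain ⟨_ | k, hi⟩ := (hB u).1 hu
      · exact hi
      · rw [hsome k] at hi
        norm_num at hi
    exact eval_initialForm_magnitude_ne_zero u w hnone hsome x (hx0 _) (hx (Sum.inl u))
  · intro hBe
    obtain ⟨a, ha⟩ := Function.ne_iff.1 hw.1
    refine ⟨a, if_pos ?_⟩
    have hu : a.1 ∉ B := by simp [hBe]
    rw [hZ, if_neg hu]
    rcases hwB' a.1 hu a.2 with h | h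
    · exact absurd h ha
    · rw [zero_add]
      exact h

/-- The direction is the sum of the block normals of `B`; with `Z` empty, the initial forms are the
equations at infinity themselves. -/
theorem not_bernsteinCondition_of_isHomSolution (hd : 0 < d) {B : Finset (FreeVertex K)}
    (hB : B.Nonempty) {x : Var K d → ℂ} (H : IsHomSolution G K p lam (finiteIndicator B) x)
    (hx : ∀ a, x a ≠ 0) : ¬ BernsteinCondition (sphereEquations G K p lam) := by
  intro hbern
  have hc : ∀ u, (0 : ℝ) <
      ((∑ j, blockDegree u (sphereEquations G K p lam j) : ℕ) : ℝ) :=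
    fun u => by exact_mod_cast sum_blockDegree_pos G K p lam hd u
  have hw := faceNormals_simplexProduct_of_blocks (I := Option (Fin d)) hc hB
  rw [← mBezoutSum_eq _ (sum_blockDegree_pos G K p lam hd)] at hw
  refine hbern _ hw ⟨x, hx, fun j => ?_⟩
  rw [eval_initialForm_of_nonempty B ∅ _ (by simp) _
    (leadSupport_sphereEquations_nonempty G K p lam hd B j)]
  simp only [Finset.notMem_empty, if_false]
  exact (homEval_sphereEquations_eq_zero_iff G K p lam hd _ x).2 H j

theorem card_freeVertex (K : Finset V) :
    Fintype.card (FreeVertex K) = Fintype.card V - K.card := by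
  rw [Fintype.card_subtype_compl, Fintype.card_coe]

theorem ncard_checks (u₀ : FreeVertex K) (k₀ : Fin d) :
    (checks K u₀ k₀).ncard =
      Fintype.card (FreeVertex K) * d ^ (Fintype.card (FreeVertex K) - 1) := by
  have h1 : checks K u₀ k₀ = ((Fintype.piFinset (fun u : FreeVertex K =>
      if u = u₀ then {k₀} else (Finset.univ : Finset (Fin d))) ×ˢ Finset.univ :
        Finset ((FreeVertex K → Fin d) × FreeVertex K)) :
        Set ((FreeVertex K → Fin d) × FreeVertex K)) := by
    ext ⟨L, u⟩
    simp only [checks, Set.mem_ofPred_eq, Finset.coe_product, Finset.coe_univ, Set.mem_prod,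
      Finset.mem_coe, Fintype.mem_piFinset, Set.mem_univ, and_true]
    constructor
    · intro h v
      split_ifs with hv
      · rw [hv, h]
        exact Finset.mem_singleton_self _
      · exact Finset.mem_univ _
    · intro h
      simpa using h u₀
  have h2 : ∀ u : FreeVertex K, (if u = u₀ then {k₀} else (Finset.univ : Finset (Fin d))).card =
      if u = u₀ then 1 else d := by
    intro u
    split_ifs <;> simp
  rw [h1, Set.ncard_coe_finset, Finset.card_product, Fintype.card_piFinset, Finset.card_univ,
    mul_comm]
  congr 1
  simp only [h2]
  rw [← Finset.mul_prod_erase _ _ (Finset.mem_univ u₀), if_pos rfl, one_mul,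
    Finset.prod_congr rfl fun u hu => if_neg (Finset.ne_of_mem_erase hu), Finset.prod_const,
    Finset.card_erase_of_mem (Finset.mem_univ _), Finset.card_univ]

end Checks

end SphereEquations

/-! ### The main theorem -/

theorem mainTheorem5 {V : Type*} [Fintype V] [DecidableEq V] (G : SimpleGraph V) (d : ℕ)
    (hG : SphereEquations.MinimallyRigid G d) (K : Finset V) (hK : G.IsNClique d K) :
    ∃ Q : MvPolynomial (({v : V // v ∈ K} × Fin d) ⊕ SphereEquations.FreeEdge G K) ℂ, Q ≠ 0 ∧
      ∀ (p : {v : V // v ∈ K} → Fin d → ℂ) (lam : SphereEquations.FreeEdge G K → ℂ),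
        MvPolynomial.eval (Sum.elim (fun a => p a.1 a.2) lam) Q ≠ 0 →
        ∀ (u₀ : SphereEquations.FreeVertex K) (k₀ : Fin d),
          {S : Finset (SphereEquations.Var K d → ℤ) | (S : Set (SphereEquations.Var K d → ℤ)) ⊆
              SphereEquations.facetNormals (SphereEquations.mBezoutSum
                (SphereEquations.sphereEquations G K p lam))}.ncard
            = 2 ^ ((d + 2) * (Fintype.card V - d)) ∧
          (SphereEquations.checks K u₀ k₀).ncard
            = (Fintype.card V - d) * d ^ (Fintype.card V - d - 1) ∧
          (SphereEquations.BernsteinCondition (SphereEquations.sphereEquations G K p lam) ↔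
            ∀ c ∈ SphereEquations.checks K u₀ k₀,
              ¬ SphereEquations.ZeroEvaluationSolvable G K p lam c.1 c.2) := by
  have hcardK : K.card = d := hK.card_eq
  rcases Nat.eq_zero_or_pos d with rfl | hd
  · exact ⟨1, one_ne_zero, fun _ _ _ _ k₀ => k₀.elim0⟩
  have hcard := SphereEquations.GenericallyRigid.card_le G K hG.1 hcardK hd
  choose QB hQB0 hQB using fun B : Finset (SphereEquations.FreeVertex K) =>
    SphereEquations.exists_generic_torus (G := G) hd B
  choose QA hQA0 hQA using SphereEquations.exists_generic_finite_ne_zero hd hcard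
  -- One polynomial handles all sets of vertices at infinity and all finite coordinates, so it does
  -- not depend on `u₀` and `k₀`.
  refine ⟨(∏ B, QB B) * ∏ a, QA a, mul_ne_zero (Finset.prod_ne_zero_iff.2 fun B _ => hQB0 B)
    (Finset.prod_ne_zero_iff.2 fun a _ => hQA0 a), fun p lam hQ u₀ k₀ => ?_⟩
  rw [map_mul, map_prod, map_prod, mul_ne_zero_iff, Finset.prod_ne_zero_iff,
    Finset.prod_ne_zero_iff] at hQ
  have hc : ∀ u, (0 : ℝ) < ((∑ j, SphereEquations.blockDegree u
      (SphereEquations.sphereEquations G K p lam j) : ℕ) : ℝ) :=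
    fun u => by exact_mod_cast SphereEquations.sum_blockDegree_pos G K p lam hd u
  have hcardV := SphereEquations.card_freeVertex K
  rw [hcardK] at hcardV
  refine ⟨?_, ?_, ?_⟩
  · rw [SphereEquations.mBezoutSum_eq _ (SphereEquations.sum_blockDegree_pos G K p lam hd),
      SphereEquations.ncard_subsets_facetNormals hc, Fintype.card_option, Fintype.card_fin, hcardV]
  · rw [SphereEquations.ncard_checks, hcardV]
  · rw [← not_iff_not]
    push Not
    constructor
    · intro hbern
      obtain ⟨B, x, H, hB, hBe⟩ :=
        SphereEquations.exists_isHomSolution_of_not_bernsteinCondition hd hbern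
      rcases B.eq_empty_or_nonempty with rfl | ⟨u, hu⟩
      · obtain ⟨a, ha⟩ := hBe rfl
        refine absurd ha (hQA a p lam (hQ.2 a (Finset.mem_univ a)) x ?_)
        convert H using 1
        ext u
        simp [SphereEquations.finiteIndicator]
      · obtain ⟨y, Hy, hy⟩ := hQB B p lam (hQ.1 B (Finset.mem_univ B)) ⟨x, H, hB⟩
        -- All coordinates of `y` are nonzero, so every choice of δ-variables works, in particular
        -- the constant one.
        exact ⟨(fun _ => k₀, u), rfl, (SphereEquations.zeroEvaluationSolvable_iff hd _ _).2
          ⟨B, y, hu, Hy, fun v => hy _⟩⟩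
    · rintro ⟨⟨L, u⟩, -, hsol⟩
      obtain ⟨B, x, hu, H, hx⟩ := (SphereEquations.zeroEvaluationSolvable_iff hd L u).1 hsol
      obtain ⟨y, Hy, hy⟩ := hQB B p lam (hQ.1 B (Finset.mem_univ B))
        ⟨x, H, fun v _ => ⟨L v, hx v⟩⟩
      exact SphereEquations.not_bernsteinCondition_of_isHomSolution hd ⟨u, hu⟩ Hy hy
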